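/- Let $\mathcal M\subset\mathbb R^m$ be an embedded smooth $d$-dimensional submanifold without boundary, let $dV$ be the Riemannian volume that $\mathcal M$ inherits from $\mathbb R^m$, and let $p\ge 0$ be a smooth function on $\mathcal M$ with $\int_{\mathcal M}p\,dV=1$. Let $x\in\mathcal M$ be a point with $p(x)>0$, and let $x_1,x_2,\dots$ be independent random points of $\mathcal M$ with common law $p\,dV$. For $\epsilon>0$ and $N\ge 1$ let $X=X_{\epsilon,N}$ be the $m\times N$ matrix with columns $$X_j=D(x)^{-1/2}\exp\Big(-\frac{\|x_j-x\|^2}{4\epsilon}\Big)(x_j-x),\qquad D(x)=\sum_{i=1}^N\exp\Big(-\frac{\|x_i-x\|^2}{2\epsilon}\Big).$$ Let $\mathcal I(x)$ be the $d\times m$ matrix (in an orthonormal basis of the tangent space $T_x\mathcal M\subset\mathbb R^m$) of the map $\mathbb R^m\to T_x\mathcal M$ that is the identity on $T_x\mathcal M$ and zero on $T_x\mathcal M^\perp$, so that $\mathcal I(x)\mathcal I(x)^\top=I_{d\times d}$ and $\mathcal I(x)^\top\mathcal I(x)$ is the orthogonal projection onto $T_x\mathcal M$. Then there is a matrix $R_{\mathcal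 I}(x)\in\mathbb R^{m\times m}$, not depending on $\epsilon$ or on the samples, such that the following holds. For every $\epsilon>0$ the limits below as $N\to\infty$ exist almost surely and are deterministic, and, as $\epsilon\to0^+$: 1. $\displaystyle\lim_{N\to\infty}\frac1\epsilon XX^\top=\mathcal I(x)^\top\mathcal I(x)+\epsilon R_{\mathcal I}(x)+\mathcal O(\epsilon^2).$ 2. Let $\sigma_1\ge\sigma_2\ge\cdots$ be the singular values of $X$ (continued by zeros). Then $\lim_{N\to\infty}\sigma_l=\sqrt\epsilon+\mathcal O(\epsilon)$ for $1\le l\le d$, and $\lim_{N\to\infty}\sigma_l=\mathcal O(\epsilon)$ for $l>d$. 3. For $v\ne0$ put $\sigma_v=\lim_{N\to\infty}\sqrt{v^\top XX^\top v}/\|v\|$. If $v\in T_x\mathcal M$, then $\sigma_v=\sqrt\epsilon+\mathcal O(\epsilon)$. If $v\in T_x\mathcal M^\perp$, then $\sigma_v=\mathcal O(\epsilon)$, and more precisely $\sigma_v^2\|v\|^2=\epsilon^2\,v^\top R_{\mathcal I}(x)v+\mathcal O(\epsilon^3)$. -/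

import Mathlib

open MeasureTheory ProbabilityTheory Filter Asymptotics
open scoped Topology ContDiff Matrix

noncomputable section

namespace TangentSVD

/-- A smooth local parametrization `φ : U → M` of a subset `M` of `ℝᵐ` by an open set `U ⊆ ℝᵈ`:
an injective immersion that maps open subsets of `U` to relatively open subsets of `M`, i.e. a
homeomorphism onto a relatively open subset of `M`. Only the values of `φ` on `U` matter. -/
structure IsLocalParam {m d : ℕ} (M : Set (EuclideanSpace ℝ (Fin m)))
    (U : Set (EuclideanSpace ℝ (Fin d)))
    (φ : EuclideanSpace ℝ (Fin d) → EuclideanSpace ℝ (Fin m)) : Prop where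
  isOpen : IsOpen U
  contDiffOn : ContDiffOn ℝ ∞ φ U
  injOn : Set.InjOn φ U
  injective_fderiv : ∀ u ∈ U, Function.Injective (fderiv ℝ φ u)
  image_open : ∀ V ⊆ U, IsOpen V → ∃ W, IsOpen W ∧ φ '' V = M ∩ W

/-- `M` is an embedded smooth `d`-dimensional submanifold (without boundary) of `ℝᵐ`. -/
def IsSubmanifold {m : ℕ} (d : ℕ) (M : Set (EuclideanSpace ℝ (Fin m))) : Prop :=
  ∀ x ∈ M, ∃ (U : Set (EuclideanSpace ℝ (Fin d)))
    (φ : EuclideanSpace ℝ (Fin d) → EuclideanSpace ℝ (Fin m)),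
    IsLocalParam M U φ ∧ x ∈ φ '' U

/-- The tangent space `T_x M ⊆ ℝᵐ`: the velocities at `x` of smooth curves in `M` through `x`.
(On a submanifold these velocities already form a subspace.) -/
def tangentAt {m : ℕ} (M : Set (EuclideanSpace ℝ (Fin m))) (x : EuclideanSpace ℝ (Fin m)) :
    Submodule ℝ (EuclideanSpace ℝ (Fin m)) :=
  Submodule.span ℝ {v | ∃ γ : ℝ → EuclideanSpace ℝ (Fin m),
    ContDiffAt ℝ ∞ γ 0 ∧ (∀ᶠ t in 𝓝 0, γ t ∈ M) ∧ γ 0 = x ∧ deriv γ 0 = v}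

/-- The matrix `g_{ij}(u) = ⟨∂ᵢφ(u), ∂ⱼφ(u)⟩` of the induced Riemannian metric in the
parametrization `φ`. -/
def metricMatrix {m d : ℕ} (φ : EuclideanSpace ℝ (Fin d) → EuclideanSpace ℝ (Fin m))
    (u : EuclideanSpace ℝ (Fin d)) : Matrix (Fin d) (Fin d) ℝ :=
  Matrix.of fun i j => inner ℝ (fderiv ℝ φ u (EuclideanSpace.single i 1))
    (fderiv ℝ φ u (EuclideanSpace.single j 1))

/-- The measure `P` is carried by `M` and has density `p` with respect to the Riemannian volume
`dV = √(det g) du` that the `d`-dimensional submanifold `M` inherits from `ℝᵐ`, i.e. `P = p dV`. -/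
def HasVolumeDensity {m : ℕ} (d : ℕ) (M : Set (EuclideanSpace ℝ (Fin m)))
    (p : EuclideanSpace ℝ (Fin m) → ℝ) (P : Measure (EuclideanSpace ℝ (Fin m))) : Prop :=
  P Mᶜ = 0 ∧
    ∀ (U : Set (EuclideanSpace ℝ (Fin d)))
      (φ : EuclideanSpace ℝ (Fin d) → EuclideanSpace ℝ (Fin m)), IsLocalParam M U φ →
      ∀ A ⊆ U, MeasurableSet A →
        P (φ '' A) = ∫⁻ u in A, ENNReal.ofReal (p (φ u) * √((metricMatrix φ u).det))

/-- `I` is the matrix, in some orthonormal basis of `T_x M`, of the map `ℝᵐ → T_x M` that is the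
identity on `T_x M` and zero on the orthogonal complement: `I` is a `d × m` matrix with `I Iᵀ = 1`,
`Iᵀ I v = v` for tangent `v`, and `I v = 0` for normal `v`. -/
structure IsTangentProj {m d : ℕ} (M : Set (EuclideanSpace ℝ (Fin m)))
    (x : EuclideanSpace ℝ (Fin m)) (I : Matrix (Fin d) (Fin m) ℝ) : Prop where
  mul_transpose : I * Iᵀ = 1
  tangent : ∀ v ∈ tangentAt M x, (Iᵀ * I).toEuclideanLin v = v
  normal : ∀ v ∈ (tangentAt M x)ᗮ, I.toEuclideanLin v = 0

/-- `D(x) = ∑_{j < N} exp(-‖x_j - x‖² / (2ε))`. -/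
def degree {m : ℕ} (x : EuclideanSpace ℝ (Fin m)) (ε : ℝ) (N : ℕ)
    (ξ : ℕ → EuclideanSpace ℝ (Fin m)) : ℝ :=
  ∑ j : Fin N, Real.exp (-‖ξ j - x‖ ^ 2 / (2 * ε))

/-- The `m × N` matrix `X` with columns
`X_j = D(x)^{-1/2} exp(-‖x_j - x‖² / (4ε)) (x_j - x)`. -/
def weightedMatrix {m : ℕ} (x : EuclideanSpace ℝ (Fin m)) (ε : ℝ) (N : ℕ)
    (ξ : ℕ → EuclideanSpace ℝ (Fin m)) : Matrix (Fin m) (Fin N) ℝ :=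
  Matrix.of fun i j =>
    (√(degree x ε N ξ))⁻¹ * Real.exp (-‖ξ j - x‖ ^ 2 / (4 * ε)) * (ξ j - x) i

/-- `√(vᵀ X Xᵀ v) / ‖v‖`, which is the singular value of `X` belonging to `v` if `v` is a left
singular vector of `X`. -/
def directionalValue {m N : ℕ} (X : Matrix (Fin m) (Fin N) ℝ) (v : EuclideanSpace ℝ (Fin m)) :
    ℝ :=
  √(v.ofLp ⬝ᵥ ((X * Xᵀ) *ᵥ v.ofLp)) / ‖v‖

end TangentSVD

end

/-! By the strong law of large numbers, each entry of `X Xᵀ` is a ratio of two averages, so for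
fixed `ε` the matrix converges almost surely to `ε L(ε)`, where `L(ε) = ∫ (y-x)(y-x)ᵀ G dP / (ε ∫ G
dP)` and `G` is the Gaussian weight of variance `ε` centred at `x`
(`tendsto_weightedMatrix_mul_transpose`). What remains is deterministic asymptotics of `L`.

Near `x` one uses a parametrization `φ` whose derivative at `0` is an isometry `J` onto the tangent
space. In it the density of `P` is smooth with value `p x` at `0`, and `‖φ u - x‖² = ‖u‖² +
O(‖u‖³)`. The Gaussian concentrates at scale `√ε`, so Laplace's method applies. The factor `√ε ^ d`
is common to numerator and denominator, and odd homogeneous Taylor terms integrate to zero, so only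
integral powers of `ε` remain through the required order (`gaussian_integral_expansion`,
`laplace_expansion`, `IsLocalParam.integral_mul_gauss_expansion`). The leading second moments `∫ (J
u) i (J u) k` against the Gaussian are a multiple of the projection onto the range of `J`. In the
quotient the constant `p x ∫ gauss` cancels, and the next coefficients form `R` (`ratio_expansion`).

Singular values are handled by Courant–Fischer (`sq_singularValues_eq_minMax`). The min-max value
depends only on `X Xᵀ`, whose size does not change with `N`, and is Lipschitz in it
(`abs_minMax_sub_le`). This gives both the limit in `N` and the perturbation in `ε`: the projection
has values `1` for `l < d` and `0` afterwards, so the squared singular values are `ε + O(ε²)` or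
`O(ε²)`. The directional statements evaluate the quadratic form of the expansion at a tangent or
normal vector. -/

namespace TangentSVD

/-! ### Taylor expansion at the origin -/

section Taylor

universe u

variable {E : Type u} [NormedAddCommGroup E] [NormedSpace ℝ E]

/-- If the derivative of `f` is `O(‖u‖ ^ n)` at the origin, then `f u - f 0` is
`O(‖u‖ ^ (n + 1))`. -/
theorem isBigO_sub_of_fderiv_isBigO {F : Type*} [NormedAddCommGroup F] [NormedSpace ℝ F]
    {f : E → F} {n : ℕ} (hf : ∀ᶠ u in 𝓝 0, DifferentiableAt ℝ f u)
    (h : fderiv ℝ f =O[𝓝 0] fun u => ‖u‖ ^ n) :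
    (fun u => f u - f 0) =O[𝓝 0] fun u => ‖u‖ ^ (n + 1) := by
  obtain ⟨C, hC0, hC⟩ := h.exists_nonneg
  obtain ⟨r, hr, hball⟩ := Metric.eventually_nhds_iff_ball.1 (hf.and hC.bound)
  refine IsBigO.of_bound C ?_
  filter_upwards [Metric.ball_mem_nhds 0 hr] with u hu
  -- The mean value inequality is used on the ball of radius `‖u‖`, where the derivative is at most
  -- `C * ‖u‖ ^ n`.
  have hsub : Metric.closedBall (0 : E) ‖u‖ ⊆ Metric.ball 0 r :=
    Metric.closedBall_subset_ball (by simpa using hu)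
  have := (convex_closedBall (0 : E) ‖u‖).norm_image_sub_le_of_norm_fderiv_le (𝕜 := ℝ) (f := f)
    (C := C * ‖u‖ ^ n) (x := 0) (y := u) (fun v hv => (hball v (hsub hv)).1) ?_
    (by simp) (by simp)
  · rw [norm_pow, norm_norm, pow_succ, ← mul_assoc]
    simpa using this
  · intro v hv
    refine (hball v (hsub hv)).2.trans ?_
    rw [norm_pow, norm_norm]
    have : ‖v‖ ≤ ‖u‖ := by simpa using hv
    gcongr

/-- Taylor expansion at the origin, with homogeneous terms. -/
theorem exists_homogeneous_expansion (n : ℕ) {F : Type u} [NormedAddCommGroup F]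
    [NormedSpace ℝ F] {f : E → F} (hf : ContDiffAt ℝ ∞ f 0) :
    ∃ T : ℕ → E → F, (∀ k, Continuous (T k)) ∧ (∀ k (t : ℝ) u, T k (t • u) = t ^ k • T k u) ∧
      (∀ k, ∃ C, ∀ u, ‖T k u‖ ≤ C * ‖u‖ ^ k) ∧
      (fun u => f u - ∑ k ∈ Finset.range n, T k u) =O[𝓝 0] fun u => ‖u‖ ^ n := by
  -- The step applies the hypothesis to `fderiv ℝ f`, with values in `E →L[ℝ] F`; this is why `E`
  -- and `F` share a universe.
  induction n generalizing F with
  | zero =>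
    refine ⟨fun _ _ => 0, fun _ => continuous_const, by simp, fun k => ⟨0, by simp⟩, ?_⟩
    simpa using hf.continuousAt.isBigO_one ℝ
  | succ n ih =>
    have hf' : ContDiffAt ℝ ∞ (fderiv ℝ f) 0 := hf.fderiv_right (by simp)
    obtain ⟨S, hSc, hSh, hSb, hS⟩ := ih hf'
    -- Integrating the expansion of the derivative along `t ↦ t • u` over `[0, 1]`: the term `t ^ j
    -- • S j u u` contributes the factor `1 / (j + 1)`.
    refine ⟨fun k => Nat.casesOn k (fun _ => f 0) (fun j u => ((j : ℝ) + 1)⁻¹ • S j u u),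
      ?_, ?_, ?_, ?_⟩
    · rintro (_ | k)
      · exact continuous_const
      · exact continuous_const.smul ((hSc k).clm_apply continuous_id)
    · rintro (_ | k) t u
      · simp
      · simp only [hSh, map_smul, smul_apply, smul_smul, pow_succ]
        congr 1; ring
    · rintro (_ | k)
      · exact ⟨‖f 0‖, by simp⟩
      · obtain ⟨C, hC⟩ := hSb k
        refine ⟨‖((k : ℝ) + 1)⁻¹‖ * C, fun u => ?_⟩
        simp only [norm_smul]
        rw [mul_assoc, pow_succ, ← mul_assoc C]
        gcongr
        exact ((S k u).le_opNorm u).trans (by gcongr; exact hC u)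
    · obtain ⟨C, hC0, hC⟩ := hS.exists_nonneg
      have hd : ∀ᶠ u in 𝓝 0, DifferentiableAt ℝ f u :=
        ((hf.of_le (m := 1) (by simp)).eventually (by simp)).mono
          fun u hu => hu.differentiableAt (by simp)
      obtain ⟨r, hr, hball⟩ := Metric.eventually_nhds_iff_ball.1 (hd.and hC.bound)
      refine IsBigO.of_bound C ?_
      filter_upwards [Metric.ball_mem_nhds 0 hr] with u hu
      have hmem : ∀ t ∈ Set.Icc (0 : ℝ) 1, t • u ∈ Metric.ball (0 : E) r := fun t ht => by
        rw [mem_ball_zero_iff, norm_smul, Real.norm_of_nonneg ht.1]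
        have : ‖u‖ < r := by simpa using hu
        nlinarith [norm_nonneg u, ht.2]
      set g : ℝ → F := fun t =>
        f (t • u) - ∑ k ∈ Finset.range n, t ^ (k + 1) • ((k : ℝ) + 1)⁻¹ • S k u u with hg
      have hder : ∀ t ∈ Set.Icc (0 : ℝ) 1, HasDerivWithinAt g
          ((fderiv ℝ f (t • u) - ∑ k ∈ Finset.range n, S k (t • u)) u) (Set.Icc 0 1) t := by
        intro t ht
        have h1 : HasDerivAt (fun t : ℝ => f (t • u)) (fderiv ℝ f (t • u) u) t := by
          have h2 : HasDerivAt (fun t : ℝ => t • u) u t := by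
            simpa using (hasDerivAt_id t).smul_const u
          exact (hball _ (hmem t ht)).1.hasFDerivAt.comp_hasDerivAt t h2
        have h3 : HasDerivAt (fun t : ℝ =>
            ∑ k ∈ Finset.range n, t ^ (k + 1) • ((k : ℝ) + 1)⁻¹ • S k u u)
            (∑ k ∈ Finset.range n, S k (t • u) u) t := by
          refine HasDerivAt.fun_sum fun k _ => ?_
          have := (hasDerivAt_pow (k + 1) t).smul_const (((k : ℝ) + 1)⁻¹ • S k u u)
          convert! this using 1
          rw [hSh, smul_smul, smul_apply]
          congr 1
          have : (k : ℝ) + 1 ≠ 0 := by positivity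
          push_cast
          field_simp
        have := (h1.fun_sub h3).hasDerivWithinAt (s := Set.Icc 0 1)
        simpa [sub_apply, sum_apply] using this
      have hmv := norm_image_sub_le_of_norm_deriv_le_segment_01' (C := C * ‖u‖ ^ n * ‖u‖) hder ?_
      · rw [norm_pow, norm_norm, pow_succ, ← mul_assoc, Finset.sum_range_succ']
        simpa [hg, sub_sub, add_comm] using hmv
      · intro t ht
        have ht' := Set.Ico_subset_Icc_self ht
        refine (ContinuousLinearMap.le_opNorm _ _).trans ?_
        gcongr
        refine (hball _ (hmem t ht')).2.trans ?_
        rw [norm_pow, norm_norm, norm_smul, Real.norm_of_nonneg ht'.1]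
        have : t * ‖u‖ ≤ ‖u‖ := by nlinarith [norm_nonneg u, ht'.2]
        have h0 := ht'.1
        gcongr

/-- The low order terms of a homogeneous expansion vanish if the function does so to that
order. -/
theorem homogeneous_term_eq_zero {f : E → ℝ} {T : ℕ → E → ℝ} {n a : ℕ} (han : a ≤ n)
    (hT : ∀ k (t : ℝ) u, T k (t • u) = t ^ k • T k u)
    (h : (fun u => f u - ∑ k ∈ Finset.range n, T k u) =O[𝓝 0] fun u => ‖u‖ ^ n)
    (hf : f =O[𝓝 0] fun u => ‖u‖ ^ a) (k : ℕ) (hk : k < a) (u : E) : T k u = 0 := by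
  have hpow : ∀ {i j : ℕ}, i ≤ j → (fun t : ℝ => t ^ j) =O[𝓝 0] fun t : ℝ => t ^ i := by
    intro i j hij
    refine IsBigO.of_bound 1 ?_
    filter_upwards [Metric.ball_mem_nhds (0 : ℝ) one_pos] with t ht
    simp only [norm_pow, one_mul]
    exact pow_le_pow_of_le_one (norm_nonneg _) (mem_ball_zero_iff.1 ht).le hij
  have hten : Tendsto (fun t : ℝ => t • u) (𝓝 0) (𝓝 0) := by
    have : Continuous fun t : ℝ => t • u := by fun_prop
    simpa using this.tendsto 0
  have hu : ∀ j, (fun t : ℝ => ‖t • u‖ ^ j) =O[𝓝 0] fun t : ℝ => t ^ j := fun j => by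
    refine IsBigO.of_bound (‖u‖ ^ j) (Eventually.of_forall fun t => ?_)
    simp [norm_smul, mul_pow, mul_comm]
  -- On the ray `t • u` the expansion is a polynomial in `t` of size `O(t ^ a)`; its coefficients
  -- below `a` are then removed one by one.
  have hsum : (fun t : ℝ => ∑ k ∈ Finset.range n, t ^ k * T k u) =O[𝓝 0] fun t : ℝ => t ^ a := by
    have h1 := (h.comp_tendsto hten).trans ((hu n).trans (hpow han))
    have h2 := (hf.comp_tendsto hten).trans (hu a)
    refine (h2.sub h1).congr_left fun t => ?_
    simp [hT]
  induction k using Nat.strong_induction_on with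
  | _ k ih =>
    have hkn : k < n := hk.trans_le han
    have h1 : (fun t : ℝ => t ^ k * T k u) =O[𝓝 0] fun t : ℝ => t ^ (k + 1) := by
      have h2 : (fun t : ℝ => ∑ j ∈ (Finset.range n).erase k, t ^ j * T j u) =O[𝓝 0]
          fun t : ℝ => t ^ (k + 1) := by
        refine IsBigO.fun_sum fun j hj => ?_
        rcases lt_trichotomy j k with hjk | hjk | hjk
        · simpa [ih j hjk (hjk.trans hk)] using isBigO_zero _ _
        · exact absurd hjk (Finset.ne_of_mem_erase hj)
        · simpa [mul_comm] using (hpow (Nat.succ_le_of_lt hjk)).const_mul_left (T j u)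
      refine ((hsum.trans (hpow hk)).sub h2).congr_left fun t => ?_
      rw [← Finset.add_sum_erase _ _ (Finset.mem_range.2 hkn)]
      ring
    obtain ⟨C, hC⟩ := h1.bound
    have h3 : ∀ᶠ t : ℝ in 𝓝[>] 0, ‖T k u‖ ≤ C * t := by
      filter_upwards [hC.filter_mono nhdsWithin_le_nhds, self_mem_nhdsWithin] with t ht ht0
      have ht0 : 0 < t := ht0
      rw [norm_mul, norm_pow, norm_pow, Real.norm_of_nonneg ht0.le, pow_succ] at ht
      have : 0 < t ^ k := by positivity
      nlinarith
    have h4 : Tendsto (fun t : ℝ => C * t) (𝓝[>] 0) (𝓝 0) := by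
      have : Continuous fun t : ℝ => C * t := by fun_prop
      simpa using (this.tendsto 0).mono_left nhdsWithin_le_nhds
    simpa using ge_of_tendsto h4 h3

end Taylor

/-! ### Gaussian moments -/

section Gauss

/-- The Gaussian weight `exp (-‖u‖² / (2ε))`. -/
noncomputable def gauss {V : Type*} [NormedAddCommGroup V] (ε : ℝ) (u : V) : ℝ :=
  Real.exp (-‖u‖ ^ 2 / (2 * ε))

variable {V : Type*} [NormedAddCommGroup V]

theorem gauss_pos (ε : ℝ) (u : V) : 0 < gauss ε u := Real.exp_pos _

theorem continuous_gauss (ε : ℝ) : Continuous (gauss ε : V → ℝ) := by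
  unfold gauss; fun_prop

theorem gauss_neg (ε : ℝ) (u : V) : gauss ε (-u) = gauss ε u := by simp [gauss]

theorem gauss_sqrt_smul [NormedSpace ℝ V] {ε : ℝ} (hε : 0 < ε) (u : V) :
    gauss ε (√ε • u) = gauss 1 u := by
  simp only [gauss, norm_smul, Real.norm_of_nonneg (Real.sqrt_nonneg _), mul_pow,
    Real.sq_sqrt hε.le]
  congr 1; field_simp

variable [InnerProductSpace ℝ V] [FiniteDimensional ℝ V] [MeasurableSpace V] [BorelSpace V]

theorem integrable_gauss {ε : ℝ} (hε : 0 < ε) : Integrable (gauss ε : V → ℝ) := by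
  have := (GaussianFourier.integrable_cexp_neg_mul_sq_norm_add (V := V)
    (b := ((1 / (2 * ε) : ℝ) : ℂ)) (by rw [Complex.ofReal_re]; positivity) 0 0).norm
  refine this.congr (Eventually.of_forall fun u => ?_)
  simp only [gauss, Complex.norm_exp]
  congr 1
  rw [zero_mul, add_zero, ← Complex.ofReal_neg, ← Complex.ofReal_pow, ← Complex.ofReal_mul,
    Complex.ofReal_re]
  ring

/-- The exponential series bounds the polynomial factor by `exp (‖u‖² / (4ε))`, which only widens
the Gaussian to bandwidth `2ε`. -/
theorem integrable_norm_pow_mul_gauss {ε : ℝ} (hε : 0 < ε) (n : ℕ) :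
    Integrable fun u : V => ‖u‖ ^ n * gauss ε u := by
  have hinteg := ((integrable_gauss (V := V) hε).add
    ((integrable_gauss (V := V) (ε := 2 * ε) (by positivity)).const_mul
      ((4 * ε) ^ n * n.factorial)))
  refine hinteg.mono' (by
    have := continuous_gauss (V := V) ε
    exact (by fun_prop : Continuous fun u : V => ‖u‖ ^ n * gauss ε u).aestronglyMeasurable)
    (Eventually.of_forall fun u => ?_)
  have hg := gauss_pos ε u
  rw [Real.norm_of_nonneg (by positivity)]
  have h1 : ‖u‖ ^ n ≤ 1 + (‖u‖ ^ 2) ^ n := by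
    rw [← pow_mul, mul_comm 2 n, pow_mul]
    nlinarith [sq_nonneg (‖u‖ ^ n - 1)]
  have h2 : (‖u‖ ^ 2) ^ n ≤ (4 * ε) ^ n * n.factorial * Real.exp (‖u‖ ^ 2 / (4 * ε)) := by
    have := Real.pow_div_factorial_le_exp (x := ‖u‖ ^ 2 / (4 * ε)) (by positivity) n
    rw [div_le_iff₀ (by positivity), div_pow, div_le_iff₀ (by positivity)] at this
    linarith
  have h3 : Real.exp (‖u‖ ^ 2 / (4 * ε)) * gauss ε u = gauss (2 * ε) u := by
    simp only [gauss, ← Real.exp_add]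
    congr 1; field_simp; ring
  calc ‖u‖ ^ n * gauss ε u
      ≤ (1 + (4 * ε) ^ n * n.factorial * Real.exp (‖u‖ ^ 2 / (4 * ε))) * gauss ε u := by
        gcongr; linarith
    _ = gauss ε u + (4 * ε) ^ n * n.factorial * gauss (2 * ε) u := by rw [← h3]; ring

theorem integrable_mul_gauss {ε : ℝ} (hε : 0 < ε) {f : V → ℝ} (hf : Continuous f) {n : ℕ} {C : ℝ}
    (hC : ∀ u, ‖f u‖ ≤ C * ‖u‖ ^ n) : Integrable fun u : V => f u * gauss ε u := by
  refine ((integrable_norm_pow_mul_gauss hε n).const_mul C).mono'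
    ((hf.mul (continuous_gauss ε)).aestronglyMeasurable) (Eventually.of_forall fun u => ?_)
  rw [norm_mul, Real.norm_of_nonneg (gauss_pos ε u).le, ← mul_assoc]
  exact mul_le_mul_of_nonneg_right (hC u) (gauss_pos ε u).le

/-- Substitution `u ↦ √ε • u`. Homogeneity is required only for `t ≥ 0`, so that powers of the norm
are covered as well. -/
theorem integral_homogeneous_mul_gauss {ε : ℝ} (hε : 0 < ε) {T : V → ℝ} {k : ℕ}
    (hT : ∀ t : ℝ, 0 ≤ t → ∀ u, T (t • u) = t ^ k • T u) :
    ∫ u, T u * gauss ε u = √ε ^ (Module.finrank ℝ V + k) * ∫ u, T u * gauss 1 u := by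
  have h := Measure.integral_comp_smul_of_nonneg (volume : Measure V)
    (fun u => T u * gauss ε u) (√ε) (hR := Real.sqrt_nonneg _)
  simp only [gauss_sqrt_smul hε, hT _ (Real.sqrt_nonneg _), smul_eq_mul, mul_assoc,
    integral_const_mul] at h
  have hs : √ε ≠ 0 := (Real.sqrt_pos.2 hε).ne'
  rw [pow_add, mul_assoc, h, ← mul_assoc, mul_inv_cancel₀ (pow_ne_zero _ hs), one_mul]

/-- Reflection `u ↦ -u`. This symmetry removes the half-integral powers of `ε` from the expansions.
-/
theorem integral_odd_mul_gauss (ε : ℝ) {T : V → ℝ} {k : ℕ} (hk : Odd k)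
    (hT : ∀ (t : ℝ) u, T (t • u) = t ^ k • T u) : ∫ u, T u * gauss ε u = 0 := by
  have h := integral_neg_eq_self (fun u => T u * gauss ε u) (volume : Measure V)
  have hneg : ∀ u, T (-u) = -T u := fun u => by
    have := hT (-1) u
    simpa [hk.neg_one_pow] using this
  simp only [gauss_neg, hneg, neg_mul, integral_neg] at h
  linarith

/-- The integral of a function dominated by `C ‖u‖ ^ k exp (-‖u‖² / (2ε))` is of order
`ε ^ ((dim V + k) / 2)`. -/
theorem norm_setIntegral_le_moment {ε : ℝ} (hε : 0 < ε) {S : Set V} (hS : MeasurableSet S)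
    {f : V → ℝ} {k : ℕ} {C : ℝ} (hC : 0 ≤ C)
    (hf : ∀ u ∈ S, ‖f u‖ ≤ C * (‖u‖ ^ k * gauss ε u)) :
    ‖∫ u in S, f u‖ ≤
      C * (√ε ^ (Module.finrank ℝ V + k) * ∫ u : V, ‖u‖ ^ k * gauss 1 u) := by
  have hinteg := (integrable_norm_pow_mul_gauss (V := V) hε k).const_mul C
  refine (norm_integral_le_of_norm_le hinteg.integrableOn
    ((ae_restrict_iff' hS).2 (Eventually.of_forall hf))).trans ?_
  refine (setIntegral_le_integral hinteg (Eventually.of_forall fun u => ?_)).trans_eq ?_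
  · have := gauss_pos ε u
    simp only [Pi.zero_apply]; positivity
  · rw [integral_const_mul, integral_homogeneous_mul_gauss hε (k := k)]
    intro t ht u
    simp [norm_smul, mul_pow, abs_of_nonneg ht]

/-- The second moments of the Gaussian weight. -/
theorem integral_inner_mul_inner_mul_gauss (a b : V) :
    ∫ u, (inner ℝ a u * inner ℝ b u) * gauss 1 u = inner ℝ a b * ∫ u : V, gauss 1 u := by
  have hfd : ∀ u : V, HasFDerivAt (gauss 1 : V → ℝ) (-(gauss 1 u) • innerSL ℝ u) u := by
    intro u
    have h1 : HasFDerivAt (fun u : V => -‖u‖ ^ 2 / (2 * 1)) (-(innerSL ℝ u)) u := by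
      have := ((hasStrictFDerivAt_norm_sq u).hasFDerivAt.neg.mul_const (2 * 1 : ℝ)⁻¹)
      convert! this using 1
      ext v; simp
    convert! h1.exp using 1
    ext v; simp [gauss]
  have hinner : ∀ u : V, HasFDerivAt (fun u : V => inner ℝ a u) (innerSL ℝ a) u := fun u =>
    (innerSL ℝ a).hasFDerivAt
  have hb : ∀ u : V, ‖inner ℝ a u * inner ℝ b u‖ ≤ (‖a‖ * ‖b‖) * ‖u‖ ^ 2 := fun u => by
    rw [norm_mul]
    calc _ ≤ (‖a‖ * ‖u‖) * (‖b‖ * ‖u‖) := by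
          gcongr <;> exact norm_inner_le_norm _ _
      _ = _ := by ring
  -- Integration by parts in direction `b`, since `⟪b, u⟫ * gauss 1 u` is minus the derivative of
  -- the Gaussian in that direction.
  have key := integral_mul_fderiv_eq_neg_fderiv_mul_of_integrable (μ := (volume : Measure V))
    (f := fun u : V => inner ℝ a u) (g := (gauss 1 : V → ℝ)) (v := b) ?_ ?_ ?_
    (fun u _ => (hinner u).differentiableAt) (fun u _ => (hfd u).differentiableAt)
  · simp only [(hfd _).fderiv, (hinner _).fderiv] at key
    simp only [smul_apply, innerSL_apply_apply, smul_eq_mul, integral_const_mul] at key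
    rw [← neg_inj, ← key, ← integral_neg]
    congr 1; ext u
    rw [real_inner_comm u b]; ring
  · simp only [(hinner _).fderiv]
    exact (integrable_gauss one_pos).const_mul _
  · simp only [(hfd _).fderiv]
    refine (integrable_mul_gauss one_pos (by fun_prop) hb).neg.congr
      (Eventually.of_forall fun u => ?_)
    simp only [smul_apply, innerSL_apply_apply, smul_eq_mul, Pi.neg_apply]
    rw [real_inner_comm u b]; ring
  · exact integrable_mul_gauss one_pos (n := 1) (C := ‖a‖) (by fun_prop) fun u => by
      simpa using norm_inner_le_norm (𝕜 := ℝ) a u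

theorem integral_gauss_pos : 0 < ∫ u : V, gauss 1 u :=
  integral_pos_of_integrable_nonneg_nonzero (x := 0) (continuous_gauss 1)
    (integrable_gauss one_pos) (fun u => (gauss_pos 1 u).le) (gauss_pos 1 0).ne'

end Gauss

/-! ### Laplace-type expansions of Gaussian integrals -/

section Laplace

/-- Phrasing local conditions as eventual in the radius allows finitely many of them to be met by
one ball. -/
theorem eventually_forall_closedBall {V : Type*} [SeminormedAddCommGroup V] {p : V → Prop}
    (h : ∀ᶠ u in 𝓝 0, p u) :
    ∀ᶠ r : ℝ in 𝓝[>] 0, ∀ u ∈ Metric.closedBall (0 : V) r, p u := by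
  obtain ⟨r, hr, hball⟩ := Metric.eventually_nhds_iff_ball.1 h
  filter_upwards [Ioo_mem_nhdsGT hr] with s hs u hu
  exact hball u (Metric.closedBall_subset_ball hs.2 hu)

theorem isBigO_of_le_sqrt_pow {F : ℝ → ℝ} {n j : ℕ} {K : ℝ}
    (h : ∀ ε : ℝ, 0 < ε → ‖F ε‖ ≤ K * √ε ^ (n + 2 * j)) :
    F =O[𝓝[>] 0] fun ε : ℝ => √ε ^ n * ε ^ j := by
  refine IsBigO.of_bound K ?_
  filter_upwards [self_mem_nhdsWithin] with ε hε
  have hε : 0 < ε := hε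
  refine (h ε hε).trans_eq ?_
  rw [pow_add, pow_mul, Real.sq_sqrt hε.le, Real.norm_of_nonneg (by positivity)]

theorem norm_pow_le_of_le_norm {V : Type*} [SeminormedAddCommGroup V] {u : V} {r : ℝ} (hr : 0 < r)
    (hu : r ≤ ‖u‖) {k n : ℕ} (hkn : k ≤ n) : ‖u‖ ^ k ≤ (r ^ (n - k))⁻¹ * ‖u‖ ^ n := by
  rw [← div_eq_inv_mul, le_div_iff₀ (by positivity)]
  conv_rhs => rw [← Nat.add_sub_cancel' hkn, pow_add]
  gcongr

theorem eventually_continuousOn_closedBall {V : Type*} [NormedAddCommGroup V] [NormedSpace ℝ V]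
    {f : V → ℝ} (hf : ContDiffAt ℝ ∞ f 0) :
    ∀ᶠ r : ℝ in 𝓝[>] 0, ContinuousOn f (Metric.closedBall 0 r) := by
  have h : ∀ᶠ u in 𝓝 0, ContinuousAt f u :=
    ((hf.of_le (m := 1) (by simp)).eventually (by simp)).mono fun u hu => hu.continuousAt
  filter_upwards [eventually_forall_closedBall h] with r hr u hu
  exact (hr u hu).continuousWithinAt

-- The Taylor expansion is used with values in `ℝ`, so its shared universe forces `V : Type`.
variable {V : Type} [NormedAddCommGroup V] [InnerProductSpace ℝ V] [FiniteDimensional ℝ V]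
  [MeasurableSpace V] [BorelSpace V]

theorem integrableOn_ball_mul_gauss {f : V → ℝ} {r : ℝ}
    (hf : ContinuousOn f (Metric.closedBall 0 r)) (ε : ℝ) :
    IntegrableOn (fun u => f u * gauss ε u) (Metric.ball 0 r) :=
  ((hf.mul (continuous_gauss ε).continuousOn).integrableOn_compact
    (isCompact_closedBall _ _)).mono_set Metric.ball_subset_closedBall

/-- Where `‖u‖ ≥ r`, the power `‖u‖ ^ k` may be traded for `‖u‖ ^ (2 * b)` at the cost of a
constant, and the higher moment supplies `ε ^ b`. -/
theorem setIntegral_mul_gauss_compl_ball_isBigO {T : V → ℝ} {k b : ℕ} {C r : ℝ} (hr : 0 < r)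
    (hk : k ≤ 2 * b) (hT : ∀ u, ‖T u‖ ≤ C * ‖u‖ ^ k) (hC : 0 ≤ C) :
    (fun ε : ℝ => ∫ u in (Metric.ball 0 r)ᶜ, T u * gauss ε u) =O[𝓝[>] 0]
      fun ε : ℝ => √ε ^ Module.finrank ℝ V * ε ^ b := by
  refine isBigO_of_le_sqrt_pow
    (K := C * (r ^ (2 * b - k))⁻¹ * ∫ u : V, ‖u‖ ^ (2 * b) * gauss 1 u) fun ε hε => ?_
  refine (norm_setIntegral_le_moment hε measurableSet_ball.compl
    (k := 2 * b) (C := C * (r ^ (2 * b - k))⁻¹) (by positivity) fun u hu => ?_).trans_eq (by ring)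
  have hu : r ≤ ‖u‖ := by simpa using hu
  have hg := (gauss_pos ε u).le
  rw [norm_mul, Real.norm_of_nonneg hg, ← mul_assoc, mul_assoc C]
  gcongr
  exact (hT u).trans (by gcongr; exact norm_pow_le_of_le_norm hr hu hk)

theorem setIntegral_mul_gauss_ball_isBigO {f : V → ℝ} {b : ℕ} {C r : ℝ} (hC : 0 ≤ C)
    (hf : ∀ u ∈ Metric.closedBall (0 : V) r, ‖f u‖ ≤ C * ‖u‖ ^ (2 * b)) :
    (fun ε : ℝ => ∫ u in Metric.ball 0 r, f u * gauss ε u) =O[𝓝[>] 0]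
      fun ε : ℝ => √ε ^ Module.finrank ℝ V * ε ^ b := by
  refine isBigO_of_le_sqrt_pow
    (K := C * ∫ u : V, ‖u‖ ^ (2 * b) * gauss 1 u) fun ε hε => ?_
  refine (norm_setIntegral_le_moment hε measurableSet_ball
    (k := 2 * b) (C := C) (by positivity) fun u hu => ?_).trans_eq (by ring)
  have hg := (gauss_pos ε u).le
  rw [norm_mul, Real.norm_of_nonneg hg, ← mul_assoc]
  gcongr
  exact hf u (Metric.ball_subset_closedBall hu)

/-- The leading term of the Gaussian integral of a homogeneous function over a ball. -/
theorem setIntegral_homogeneous_mul_gauss {T : V → ℝ} (hTc : Continuous T) {k b : ℕ} {C r : ℝ}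
    (hr : 0 < r) (hk : k ≤ 2 * b) (hT : ∀ u, ‖T u‖ ≤ C * ‖u‖ ^ k) (hC : 0 ≤ C)
    (hh : ∀ (t : ℝ) u, T (t • u) = t ^ k • T u) :
    (fun ε : ℝ => (∫ u in Metric.ball 0 r, T u * gauss ε u) -
      √ε ^ (Module.finrank ℝ V + k) * ∫ u, T u * gauss 1 u) =O[𝓝[>] 0]
      fun ε : ℝ => √ε ^ Module.finrank ℝ V * ε ^ b := by
  refine (setIntegral_mul_gauss_compl_ball_isBigO hr hk hT hC).neg_left.congr' ?_
    EventuallyEq.rfl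
  filter_upwards [self_mem_nhdsWithin] with ε hε
  have hε : 0 < ε := hε
  have h1 := integral_add_compl (measurableSet_ball (x := (0 : V)) (ε := r))
    (integrable_mul_gauss hε hTc hT)
  rw [integral_homogeneous_mul_gauss hε (fun t _ u => hh t u)] at h1
  rw [← h1]; ring

/-- The Gaussian integral of a smooth function that vanishes to odd order has an expansion in
integral powers. -/
theorem gaussian_integral_expansion {f : V → ℝ} (hf : ContDiffAt ℝ ∞ f 0) (b : ℕ)
    (hfO : f =O[𝓝 0] fun u => ‖u‖ ^ (2 * b + 1)) :
    ∀ᶠ r : ℝ in 𝓝[>] 0, ∃ c : ℝ,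
      (fun ε : ℝ => (∫ u in Metric.ball 0 r, f u * gauss ε u) -
        c * (√ε ^ Module.finrank ℝ V * ε ^ (b + 1))) =O[𝓝[>] 0]
      fun ε : ℝ => √ε ^ Module.finrank ℝ V * ε ^ (b + 2) := by
  -- Only degrees `2b+1`, `2b+2`, `2b+3` survive below the remainder. The odd two integrate to zero
  -- and the middle one gives `c`.
  obtain ⟨T, hTc, hTh, hTb, hT⟩ := exists_homogeneous_expansion (2 * b + 4) hf
  have hzero := homogeneous_term_eq_zero (by omega) hTh hT hfO
  have hsum : ∀ u, ∑ k ∈ Finset.range (2 * b + 4), T k u =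
      T (2 * b + 1) u + T (2 * b + 2) u + T (2 * b + 3) u := fun u => by
    rw [Finset.sum_range_succ, Finset.sum_range_succ, Finset.sum_range_succ,
      Finset.sum_eq_zero fun k hk => hzero k (Finset.mem_range.1 hk) u, zero_add]
  simp only [hsum] at hT
  obtain ⟨C, hC0, hC⟩ := hT.exists_nonneg
  have hTb' : ∀ k, ∃ C, 0 ≤ C ∧ ∀ u, ‖T k u‖ ≤ C * ‖u‖ ^ k := fun k => by
    obtain ⟨C, hC⟩ := hTb k
    exact ⟨|C|, abs_nonneg C, fun u => (hC u).trans (by gcongr; exact le_abs_self C)⟩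
  choose B hB0 hB using hTb'
  filter_upwards [eventually_forall_closedBall hC.bound, self_mem_nhdsWithin,
    eventually_continuousOn_closedBall hf] with r hr hr0 hfc
  refine ⟨∫ u, T (2 * b + 2) u * gauss 1 u, ?_⟩
  have hrem := setIntegral_mul_gauss_ball_isBigO (V := V) (b := b + 2) (r := r) hC0
    (f := fun u => f u - (T (2 * b + 1) u + T (2 * b + 2) u + T (2 * b + 3) u))
    (fun u hu => by simpa [mul_add] using hr u hu)
  have hterm := fun k (hk : k ≤ 2 * (b + 2)) =>
    setIntegral_homogeneous_mul_gauss (hTc k) hr0 hk (hB k) (hB0 k) (hTh k)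
  refine (((hrem.add (hterm (2 * b + 1) (by omega))).add (hterm (2 * b + 2) (by omega))).add
    (hterm (2 * b + 3) (by omega))).congr' ?_ EventuallyEq.rfl
  filter_upwards [self_mem_nhdsWithin] with ε hε
  have hε : 0 < ε := hε
  have hTi : ∀ k, IntegrableOn (fun u => T k u * gauss ε u) (Metric.ball 0 r) := fun k =>
    integrableOn_ball_mul_gauss (hTc k).continuousOn ε
  have hfi := integrableOn_ball_mul_gauss hfc ε
  rw [integral_odd_mul_gauss 1 ⟨b, rfl⟩ (hTh (2 * b + 1)),
    integral_odd_mul_gauss 1 ⟨b + 1, by ring⟩ (hTh (2 * b + 3))]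
  have hsplit : ∫ u in Metric.ball 0 r,
      (f u - (T (2 * b + 1) u + T (2 * b + 2) u + T (2 * b + 3) u)) * gauss ε u =
      (∫ u in Metric.ball 0 r, f u * gauss ε u) -
        ((∫ u in Metric.ball 0 r, T (2 * b + 1) u * gauss ε u) +
          (∫ u in Metric.ball 0 r, T (2 * b + 2) u * gauss ε u) +
          (∫ u in Metric.ball 0 r, T (2 * b + 3) u * gauss ε u)) := by
    have h12 : IntegrableOn (fun u => T (2 * b + 1) u * gauss ε u + T (2 * b + 2) u * gauss ε u)
      (Metric.ball 0 r) := (hTi _).add (hTi _)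
    have h123 : IntegrableOn (fun u => T (2 * b + 1) u * gauss ε u + T (2 * b + 2) u * gauss ε u +
      T (2 * b + 3) u * gauss ε u) (Metric.ball 0 r) := h12.add (hTi _)
    simp only [sub_mul, add_mul]
    rw [integral_sub hfi h123, integral_add h12 (hTi _), integral_add (hTi _) (hTi _)]
  have hpow : √ε ^ (Module.finrank ℝ V + (2 * b + 2)) =
      √ε ^ Module.finrank ℝ V * ε ^ (b + 1) := by
    rw [pow_add, show 2 * b + 2 = 2 * (b + 1) by ring, pow_mul √ε 2, Real.sq_sqrt hε.le]
  rw [hsplit, hpow]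
  ring

theorem isBigO_mul_inv_pow {F : ℝ → ℝ} {n j k : ℕ} (s : ℝ)
    (h : F =O[𝓝[>] 0] fun ε : ℝ => √ε ^ n * ε ^ (j + k)) :
    (fun ε : ℝ => s * (ε ^ k)⁻¹ * F ε) =O[𝓝[>] 0] fun ε : ℝ => √ε ^ n * ε ^ j := by
  refine (((isBigO_refl (fun ε : ℝ => (ε ^ k)⁻¹) _).const_mul_left s).mul h).congr'
    EventuallyEq.rfl ?_
  filter_upwards [self_mem_nhdsWithin] with ε hε
  have hε : 0 < ε := hε
  rw [pow_add]; field_simp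

theorem norm_pow_isBigO_norm_pow {V : Type*} [SeminormedAddCommGroup V] {i j : ℕ} (hij : i ≤ j) :
    (fun u : V => ‖u‖ ^ j) =O[𝓝 0] fun u : V => ‖u‖ ^ i := by
  refine IsBigO.of_bound 1 ?_
  filter_upwards [Metric.ball_mem_nhds (0 : V) one_pos] with u hu
  simp only [norm_pow, norm_norm, one_mul]
  exact pow_le_pow_of_le_one (norm_nonneg _) (mem_ball_zero_iff.1 hu).le hij

theorem abs_exp_sub_sum_le (t : ℝ) :
    |Real.exp t - (1 + t + t ^ 2 / 2 + t ^ 3 / 6)| ≤ |t| ^ 4 * Real.exp |t| := by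
  have h := Complex.norm_exp_sub_sum_le_norm_mul_exp (t : ℂ) 4
  rw [Complex.norm_real, Real.norm_eq_abs] at h
  refine le_trans (le_of_eq ?_) h
  rw [← Real.norm_eq_abs, ← Complex.norm_real]
  congr 1
  simp only [Finset.sum_range_succ, Finset.sum_range_zero, Nat.factorial]
  push_cast
  ring

/-- The cubic and higher corrections `κ` to the phase only contribute to the expansion with
relative order `ε`. -/
theorem laplace_expansion {h h₀ κ : V → ℝ} (hh : ContDiffAt ℝ ∞ h 0) (hh₀ : ContDiff ℝ ∞ h₀)
    (hκ : ContDiffAt ℝ ∞ κ 0) (a : ℕ) {C₀ : ℝ} (hC₀ : ∀ u, ‖h₀ u‖ ≤ C₀ * ‖u‖ ^ (2 * a))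
    (hhom : ∀ (t : ℝ) u, h₀ (t • u) = t ^ (2 * a) • h₀ u)
    (hdiff : (fun u => h u - h₀ u) =O[𝓝 0] fun u => ‖u‖ ^ (2 * a + 1))
    (hκO : κ =O[𝓝 0] fun u => ‖u‖ ^ 3) :
    ∀ᶠ r : ℝ in 𝓝[>] 0, ∃ c : ℝ,
      (fun ε : ℝ => (∫ u in Metric.ball 0 r, h u * Real.exp (-(‖u‖ ^ 2 + κ u) / (2 * ε))) -
        √ε ^ Module.finrank ℝ V * (ε ^ a * (∫ u, h₀ u * gauss 1 u) + c * ε ^ (a + 1)))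
      =O[𝓝[>] 0] fun ε : ℝ => √ε ^ Module.finrank ℝ V * ε ^ (a + 2) := by
  have hhO : h =O[𝓝 0] fun u => ‖u‖ ^ (2 * a) := by
    have h1 : h₀ =O[𝓝 0] fun u => ‖u‖ ^ (2 * a) :=
      IsBigO.of_bound C₀ (Eventually.of_forall fun u => by simpa using hC₀ u)
    refine ((hdiff.trans (norm_pow_isBigO_norm_pow (by omega))).add h1).congr_left fun u => ?_
    ring
  have hκpow : ∀ k, (fun u => κ u ^ k * h u) =O[𝓝 0] fun u => ‖u‖ ^ (3 * k + 2 * a) := fun k =>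
    ((hκO.pow k).mul hhO).congr_right fun u => by rw [← pow_mul, ← pow_add]
  have hκs : ∀ k, ContDiffAt ℝ ∞ (fun u => κ u ^ k * h u) 0 := fun k => (hκ.pow k).mul hh
  obtain ⟨Ch, hCh0, hCh⟩ := hhO.exists_nonneg
  obtain ⟨Cκ, hCκ0, hCκ⟩ := hκO.exists_nonneg
  have hκsmall : ∀ᶠ u : V in 𝓝 0, |κ u| ≤ ‖u‖ ^ 2 / 2 := by
    have h1 : κ =o[𝓝 0] fun u => ‖u‖ ^ 2 :=
      hκO.trans_isLittleO (isLittleO_norm_pow_norm_pow (by norm_num))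
    filter_upwards [h1.bound (show (0 : ℝ) < 1 / 2 by norm_num)] with u hu
    rw [norm_pow, norm_norm, Real.norm_eq_abs] at hu
    linarith
  -- The integral of `κ ^ k * h`, which vanishes to order `3k + 2a`, will be divided by `ε ^ k`. The
  -- difference `h - h₀` and the terms `k = 1, 2` thus all enter at `ε ^ (a + 1)`; the term `k = 3`
  -- is already `O(ε ^ (a + 2))`.
  have hexp0 := gaussian_integral_expansion (hh.sub hh₀.contDiffAt) a hdiff
  have hexp1 := gaussian_integral_expansion (hκs 1) (a + 1)
    ((hκpow 1).trans (norm_pow_isBigO_norm_pow (by omega)))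
  have hexp2 := gaussian_integral_expansion (hκs 2) (a + 2)
    ((hκpow 2).trans (norm_pow_isBigO_norm_pow (by omega)))
  have hexp3 := gaussian_integral_expansion (hκs 3) (a + 4)
    ((hκpow 3).trans (norm_pow_isBigO_norm_pow (by omega)))
  filter_upwards [hexp0, hexp1, hexp2, hexp3, eventually_forall_closedBall hκsmall,
    eventually_forall_closedBall hCh.bound, eventually_forall_closedBall hCκ.bound,
    eventually_continuousOn_closedBall hh, eventually_continuousOn_closedBall hκ,
    self_mem_nhdsWithin] with r h0 h1 h2 h3 hs hb hbκ hhc hκc hr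
  obtain ⟨c0, h0⟩ := h0
  obtain ⟨c1, h1⟩ := h1
  obtain ⟨c2, h2⟩ := h2
  obtain ⟨c3, h3⟩ := h3
  -- The weights are the coefficients `(-1/2) ^ k / k!` of `exp (-κ / (2ε))`.
  refine ⟨c0 - c1 / 2 + c2 / 8, ?_⟩
  have hC₀' : ∀ u, ‖h₀ u‖ ≤ |C₀| * ‖u‖ ^ (2 * a) := fun u =>
    (hC₀ u).trans (by gcongr; exact le_abs_self _)
  have hlead := setIntegral_homogeneous_mul_gauss hh₀.continuous (b := a + 2) hr (by omega) hC₀'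
    (abs_nonneg _) hhom
  have h0' : (fun ε : ℝ => (∫ u in Metric.ball 0 r, (h u - h₀ u) * gauss ε u) -
      c0 * (√ε ^ Module.finrank ℝ V * ε ^ (a + 1))) =O[𝓝[>] 0]
      fun ε : ℝ => √ε ^ Module.finrank ℝ V * ε ^ (a + 2) := h0
  have h1' := isBigO_mul_inv_pow (j := a + 2) (k := 1) (-1 / 2) h1
  have h2' := isBigO_mul_inv_pow (j := a + 2) (k := 2) (1 / 8) h2
  have h3' : (fun ε : ℝ => ∫ u in Metric.ball 0 r, (κ u ^ 3 * h u) * gauss ε u) =O[𝓝[>] 0]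
      fun ε : ℝ => √ε ^ Module.finrank ℝ V * ε ^ (a + 2 + 3) := by
    have e1 : (fun ε : ℝ => √ε ^ Module.finrank ℝ V * ε ^ (a + 4 + 2)) =O[𝓝[>] 0]
        fun ε : ℝ => √ε ^ Module.finrank ℝ V * ε ^ (a + 2 + 3) := by
      refine (isBigO_refl _ _).mul ?_
      refine IsBigO.of_norm_norm ?_
      simpa only [norm_pow] using (norm_pow_isBigO_norm_pow (V := ℝ)
        (show a + 2 + 3 ≤ a + 4 + 2 by omega)).mono nhdsWithin_le_nhds
    refine ((h3.trans e1).add ((isBigO_refl _ _).const_mul_left c3)).congr_left fun ε => ?_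
    ring
  have h3'' := isBigO_mul_inv_pow (j := a + 2) (k := 3) (-1 / 48) h3'
  have hrem : (fun ε : ℝ => ∫ u in Metric.ball 0 r, (Real.exp (-κ u / (2 * ε)) -
      (1 + (-κ u / (2 * ε)) + (-κ u / (2 * ε)) ^ 2 / 2 + (-κ u / (2 * ε)) ^ 3 / 6)) *
      (h u * gauss ε u)) =O[𝓝[>] 0]
      fun ε : ℝ => √ε ^ Module.finrank ℝ V * ε ^ (a + 2) := by
    refine isBigO_of_le_sqrt_pow (K := Cκ ^ 4 * Ch / 16 *
      (√2 ^ (Module.finrank ℝ V + (2 * a + 12)) *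
        ∫ u : V, ‖u‖ ^ (2 * a + 12) * gauss 1 u)) fun ε hε => ?_
    -- Since `|κ u| ≤ ‖u‖² / 2`, the factor `exp |κ / (2ε)|` only doubles the bandwidth. The
    -- fourth-order remainder has `‖u‖ ^ (2a + 12) / ε ^ 4`, which integrates to relative order `ε ^
    -- (a + 2)`.
    refine (norm_setIntegral_le_moment (ε := 2 * ε) (by positivity) measurableSet_ball
      (k := 2 * a + 12) (C := Cκ ^ 4 * Ch / (16 * ε ^ 4)) (by positivity)
      fun u hu => ?_).trans_eq ?_
    · have hu' := Metric.ball_subset_closedBall hu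
      have hg := (gauss_pos ε u).le
      have b1 := hb u hu'
      have b2 := hbκ u hu'
      have b3 := hs u hu'
      rw [norm_pow, norm_norm] at b1 b2
      have habs : |(-κ u / (2 * ε))| = |κ u| / (2 * ε) := by
        rw [abs_div, abs_neg, abs_of_pos (by positivity : 0 < 2 * ε)]
      have hg2 : Real.exp (‖u‖ ^ 2 / (4 * ε)) * gauss ε u = gauss (2 * ε) u := by
        simp only [gauss, ← Real.exp_add]
        congr 1; field_simp; ring
      rw [norm_mul, norm_mul, Real.norm_of_nonneg hg, Real.norm_eq_abs]
      calc _ ≤ ((Cκ * ‖u‖ ^ 3 / (2 * ε)) ^ 4 * Real.exp (‖u‖ ^ 2 / (4 * ε))) *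
            ((Ch * ‖u‖ ^ (2 * a)) * gauss ε u) := by
            refine mul_le_mul ((abs_exp_sub_sum_le _).trans ?_)
              (mul_le_mul_of_nonneg_right b1 hg) (by positivity) (by positivity)
            rw [habs]
            have b4 : |κ u| / (2 * ε) ≤ ‖u‖ ^ 2 / (4 * ε) := by
              rw [div_le_div_iff₀ (by positivity) (by positivity)]
              nlinarith
            refine mul_le_mul ?_ (Real.exp_le_exp.2 b4) (by positivity) (by positivity)
            gcongr
            exact b2
        _ = Cκ ^ 4 * Ch / (16 * ε ^ 4) * (‖u‖ ^ (2 * a + 12) *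
            (Real.exp (‖u‖ ^ 2 / (4 * ε)) * gauss ε u)) := by
            field_simp; ring
        _ = _ := by rw [hg2]
    · rw [Real.sqrt_mul (by norm_num), mul_pow √2]
      have e2 : √ε ^ (Module.finrank ℝ V + (2 * a + 12)) =
          √ε ^ (Module.finrank ℝ V + 2 * (a + 2)) * ε ^ 4 := by
        rw [show Module.finrank ℝ V + (2 * a + 12) = Module.finrank ℝ V + 2 * (a + 2) + 2 * 4 by
          ring, pow_add _ _ (2 * 4), pow_mul √ε 2 4, Real.sq_sqrt hε.le]
      rw [e2]; field_simp
  refine (((((hlead.add h0').add h1').add h2').add h3'').add hrem).congr' ?_ EventuallyEq.rfl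
  filter_upwards [self_mem_nhdsWithin] with ε hε
  have hε : 0 < ε := hε
  have i0 : IntegrableOn (fun u => h₀ u * gauss ε u) (Metric.ball 0 r) :=
    integrableOn_ball_mul_gauss hh₀.continuous.continuousOn ε
  have i1 : IntegrableOn (fun u => (h u - h₀ u) * gauss ε u) (Metric.ball 0 r) :=
    integrableOn_ball_mul_gauss (hhc.sub hh₀.continuous.continuousOn) ε
  have ik : ∀ k, IntegrableOn (fun u => (κ u ^ k * h u) * gauss ε u) (Metric.ball 0 r) :=
    fun k => integrableOn_ball_mul_gauss ((hκc.pow k).mul hhc) ε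
  have ifull : IntegrableOn (fun u => h u * Real.exp (-(‖u‖ ^ 2 + κ u) / (2 * ε)))
      (Metric.ball 0 r) := by
    have hc : ContinuousOn (fun u => h u * Real.exp (-(‖u‖ ^ 2 + κ u) / (2 * ε)))
        (Metric.closedBall 0 r) := by fun_prop
    exact (hc.integrableOn_compact (isCompact_closedBall _ _)).mono_set
      Metric.ball_subset_closedBall
  have hsplit : ∫ u in Metric.ball 0 r, (Real.exp (-κ u / (2 * ε)) -
      (1 + (-κ u / (2 * ε)) + (-κ u / (2 * ε)) ^ 2 / 2 + (-κ u / (2 * ε)) ^ 3 / 6)) *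
      (h u * gauss ε u) =
      (∫ u in Metric.ball 0 r, h u * Real.exp (-(‖u‖ ^ 2 + κ u) / (2 * ε))) -
      (∫ u in Metric.ball 0 r, h₀ u * gauss ε u) -
      (∫ u in Metric.ball 0 r, (h u - h₀ u) * gauss ε u) -
      (-1 / 2) * (ε ^ 1)⁻¹ * (∫ u in Metric.ball 0 r, (κ u ^ 1 * h u) * gauss ε u) -
      (1 / 8) * (ε ^ 2)⁻¹ * (∫ u in Metric.ball 0 r, (κ u ^ 2 * h u) * gauss ε u) -
      (-1 / 48) * (ε ^ 3)⁻¹ * (∫ u in Metric.ball 0 r, (κ u ^ 3 * h u) * gauss ε u) := by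
    rw [← integral_const_mul, ← integral_const_mul, ← integral_const_mul]
    have j1 := ifull.sub i0
    have j2 := j1.sub i1
    have j3 := j2.sub ((ik 1).const_mul ((-1 / 2) * (ε ^ 1)⁻¹))
    have j4 := j3.sub ((ik 2).const_mul ((1 / 8) * (ε ^ 2)⁻¹))
    rw [← integral_sub' ifull i0, ← integral_sub' j1 i1, ← integral_sub' j2 ((ik 1).const_mul _),
      ← integral_sub' j3 ((ik 2).const_mul _), ← integral_sub' j4 ((ik 3).const_mul _)]
    congr 1; ext u
    have hprod : Real.exp (-(‖u‖ ^ 2 + κ u) / (2 * ε)) =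
        Real.exp (-κ u / (2 * ε)) * gauss ε u := by
      rw [gauss, ← Real.exp_add]; congr 1; ring
    simp only [Pi.sub_apply, hprod]
    field_simp
    ring
  rw [hsplit, pow_add √ε _ (2 * a), pow_mul √ε 2 a, Real.sq_sqrt hε.le]
  field_simp
  ring

end Laplace

/-! ### A variational characterization of singular values -/

section MinMax

open Module

variable {G H : Type*} [NormedAddCommGroup G] [InnerProductSpace ℝ G] [FiniteDimensional ℝ G]
  [NormedAddCommGroup H] [InnerProductSpace ℝ H] [FiniteDimensional ℝ H]

/-- Diagonalizes `T* T` in its eigenbasis, which turns singular-value inequalities into termwise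
comparisons. -/
theorem norm_sq_apply_eq_sum (T : G →ₗ[ℝ] H) (w : G) :
    ‖T w‖ ^ 2 = ∑ i : Fin (finrank ℝ G), T.singularValues i ^ 2 *
      inner ℝ (T.isSymmetric_adjoint_comp_self.eigenvectorBasis rfl i) w ^ 2 := by
  set b := T.isSymmetric_adjoint_comp_self.eigenvectorBasis rfl with hb
  have h1 : ‖T w‖ ^ 2 = inner ℝ w ((LinearMap.adjoint T ∘ₗ T) w) := by
    rw [LinearMap.comp_apply, LinearMap.adjoint_inner_right, real_inner_self_eq_norm_sq]
  rw [h1, ← b.sum_inner_mul_inner]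
  refine Finset.sum_congr rfl fun i _ => ?_
  rw [← T.isSymmetric_adjoint_comp_self, hb,
    LinearMap.IsSymmetric.apply_eigenvectorBasis, ← hb, ← T.sq_singularValues_fin rfl i,
    real_inner_smul_left, real_inner_comm]
  simp only [RCLike.ofReal_real_eq_id, id_eq]
  ring

theorem norm_sq_adjoint_apply_apply_eq_sum (T : G →ₗ[ℝ] H) (w : G) :
    ‖LinearMap.adjoint T (T w)‖ ^ 2 = ∑ i : Fin (finrank ℝ G),
      (T.singularValues i ^ 2) ^ 2 *
      inner ℝ (T.isSymmetric_adjoint_comp_self.eigenvectorBasis rfl i) w ^ 2 := by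
  set b := T.isSymmetric_adjoint_comp_self.eigenvectorBasis rfl with hb
  rw [← b.sum_sq_norm_inner_right]
  refine Finset.sum_congr rfl fun i _ => ?_
  rw [← LinearMap.comp_apply, ← T.isSymmetric_adjoint_comp_self, hb,
    LinearMap.IsSymmetric.apply_eigenvectorBasis, ← hb, ← T.sq_singularValues_fin rfl i,
    real_inner_smul_left, Real.norm_eq_abs, sq_abs, mul_pow]
  simp

/-- Off a suitable subspace of dimension `l`, the adjoint is bounded by the `l`-th singular
value. -/
theorem exists_submodule_norm_adjoint_le (T : G →ₗ[ℝ] H) (l : ℕ) :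
    ∃ W : Submodule ℝ H, finrank ℝ W ≤ l ∧
      ∀ v ∈ Wᗮ, ‖LinearMap.adjoint T v‖ ≤ T.singularValues l * ‖v‖ := by
  set b := T.isSymmetric_adjoint_comp_self.eigenvectorBasis rfl with hb
  -- If `v` is orthogonal to these images, then `T* v` has no component along `b i` for `i < l`.
  refine ⟨Submodule.span ℝ (Set.range fun i : {i : Fin (finrank ℝ G) // i.1 < l} => T (b i)),
    ?_, fun v hv => ?_⟩
  · refine (finrank_range_le_card _).trans ?_
    have : Function.Injective fun i : {i : Fin (finrank ℝ G) // i.1 < l} =>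
        (⟨i.1.1, i.2⟩ : Fin l) := fun i j hij => by
      simpa [Subtype.ext_iff, Fin.ext_iff] using hij
    simpa using Fintype.card_le_of_injective _ this
  · set w := LinearMap.adjoint T v with hw
    have h0 : ∀ i : Fin (finrank ℝ G), i.1 < l → inner ℝ (b i) w = 0 := fun i hi => by
      rw [hw, LinearMap.adjoint_inner_right]
      exact (Submodule.mem_orthogonal _ _).1 hv _ (Submodule.subset_span ⟨⟨i, hi⟩, rfl⟩)
    have h1 : ‖T w‖ ≤ T.singularValues l * ‖w‖ := by
      refine le_of_sq_le_sq ?_ (mul_nonneg (T.singularValues_nonneg l) (norm_nonneg _))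
      rw [mul_pow, norm_sq_apply_eq_sum, ← b.sum_sq_norm_inner_right, Finset.mul_sum]
      refine Finset.sum_le_sum fun i _ => ?_
      rw [Real.norm_eq_abs, sq_abs]
      rcases lt_or_ge i.1 l with hi | hi
      · simp [← hb, h0 i hi]
      · gcongr
        · exact T.singularValues_nonneg _
        · exact T.singularValues_antitone hi
    have h2 : ‖w‖ ^ 2 ≤ ‖v‖ * (T.singularValues l * ‖w‖) := by
      rw [← real_inner_self_eq_norm_sq]
      conv_lhs => rw [hw, LinearMap.adjoint_inner_left, ← hw]
      exact (real_inner_le_norm _ _).trans (by gcongr)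
    rcases (norm_nonneg w).eq_or_lt with h | h
    · rw [← h]; exact mul_nonneg (T.singularValues_nonneg l) (norm_nonneg _)
    · nlinarith

/-- Every subspace of dimension at most `l` is orthogonal to a vector on which the adjoint is at
least the `l`-th singular value. -/
theorem exists_mem_orthogonal_le_norm_adjoint (T : G →ₗ[ℝ] H) (l : ℕ) (W : Submodule ℝ H)
    (hW : finrank ℝ W ≤ l) :
    ∃ v ∈ Wᗮ, ‖v‖ ≤ 1 ∧ T.singularValues l ^ 2 ≤ ‖LinearMap.adjoint T v‖ ^ 2 := by
  rcases (T.singularValues_nonneg l).eq_or_lt with hσ | hσ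
  · exact ⟨0, zero_mem _, by simp, by simp [← hσ]⟩
  have hl : l < finrank ℝ G := by
    by_contra! h
    exact hσ.ne' (T.singularValues_of_finrank_le h)
  set b := T.isSymmetric_adjoint_comp_self.eigenvectorBasis rfl with hb
  -- A kernel vector `w` lies in the span of `b 0, …, b l` and has `T w ⟂ W`. There are at most
  -- `(dim G - (l + 1)) + l < dim G` conditions, so a nonzero one exists; `T w`, normalized, is the
  -- witness.
  let Φ : G →ₗ[ℝ] ({j : Fin (finrank ℝ G) // l < j.1} → ℝ) × W :=
    (LinearMap.pi fun j => (innerSL ℝ (b j.1)).toLinearMap).prod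
      (W.orthogonalProjectionOnto.toLinearMap ∘ₗ T)
  have hker : LinearMap.ker Φ ≠ ⊥ := by
    refine LinearMap.ker_ne_bot_of_finrank_lt ?_
    have hcard : Fintype.card {j : Fin (finrank ℝ G) // l < j.1} ≤ finrank ℝ G - (l + 1) := by
      have : Function.Injective fun j : {j : Fin (finrank ℝ G) // l < j.1} =>
          (⟨j.1.1 - (l + 1), by omega⟩ : Fin (finrank ℝ G - (l + 1))) := fun i j hij => by
        have hi := i.2
        have hj := j.2
        simp only [Fin.mk.injEq] at hij
        exact Subtype.ext (Fin.ext (by omega))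
      simpa using Fintype.card_le_of_injective _ this
    rw [Module.finrank_prod, Module.finrank_fintype_fun_eq_card]
    omega
  obtain ⟨w, hw, hw0⟩ := (Submodule.ne_bot_iff _).1 hker
  have hΦ : Φ w = 0 := hw
  have h0 : ∀ j : Fin (finrank ℝ G), l < j.1 → inner ℝ (b j) w = 0 := fun j hj =>
    congrFun (congrArg Prod.fst hΦ) ⟨j, hj⟩
  have hTw : T w ∈ Wᗮ := by
    have : W.orthogonalProjectionOnto (T w) = 0 := congrArg Prod.snd hΦ
    exact Submodule.orthogonalProjectionOnto_eq_zero_iff.1 this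
  have hle1 : T.singularValues l ^ 2 * ‖w‖ ^ 2 ≤ ‖T w‖ ^ 2 := by
    rw [norm_sq_apply_eq_sum, ← b.sum_sq_norm_inner_right, Finset.mul_sum]
    refine Finset.sum_le_sum fun i _ => ?_
    rw [Real.norm_eq_abs, sq_abs]
    rcases lt_or_ge l i.1 with hi | hi
    · simp [← hb, h0 i hi]
    · gcongr
      exact T.singularValues_antitone hi
  have hle2 : T.singularValues l ^ 2 * ‖T w‖ ^ 2 ≤ ‖LinearMap.adjoint T (T w)‖ ^ 2 := by
    rw [norm_sq_adjoint_apply_apply_eq_sum, norm_sq_apply_eq_sum, Finset.mul_sum]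
    refine Finset.sum_le_sum fun i _ => ?_
    rcases lt_or_ge l i.1 with hi | hi
    · simp [← hb, h0 i hi]
    · rw [← mul_assoc]
      refine mul_le_mul_of_nonneg_right ?_ (sq_nonneg _)
      rw [sq (T.singularValues i ^ 2)]
      gcongr
      exact T.singularValues_antitone hi
  have hpos : 0 < ‖T w‖ := by
    have : 0 < ‖w‖ := norm_pos_iff.2 hw0
    have h3 : 0 < ‖T w‖ ^ 2 := lt_of_lt_of_le (by positivity) hle1
    exact lt_of_le_of_ne (norm_nonneg _) fun h => by simp [← h] at h3
  refine ⟨‖T w‖⁻¹ • T w, Submodule.smul_mem _ _ hTw, ?_, ?_⟩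
  · rw [norm_smul, norm_inv, norm_norm, inv_mul_cancel₀ hpos.ne']
  · rw [map_smul, norm_smul, norm_inv, norm_norm, mul_pow, inv_pow, ← div_eq_inv_mul,
      le_div_iff₀ (by positivity)]
    exact hle2

/-- The Courant–Fischer value `min_{dim W ≤ l} max_{v ⟂ W, ‖v‖ ≤ 1} ⟪v, A v⟫`. -/
noncomputable def minMax (A : H →ₗ[ℝ] H) (l : ℕ) : ℝ :=
  ⨅ W : {W : Submodule ℝ H // finrank ℝ W ≤ l}, ⨆ v : {v : H // v ∈ W.1ᗮ ∧ ‖v‖ ≤ 1},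
    inner ℝ v.1 (A v.1)

/-- The unit ball, unlike the sphere, is nonempty even if `Wᗮ = ⊥`; the value then is `0`, matching
singular values continued by zeros. -/
instance (W : Submodule ℝ H) : Nonempty {v : H // v ∈ Wᗮ ∧ ‖v‖ ≤ 1} := ⟨⟨0, zero_mem _, by simp⟩⟩

instance (l : ℕ) : Nonempty {W : Submodule ℝ H // finrank ℝ W ≤ l} := ⟨⟨⊥, by simp⟩⟩

theorem bddAbove_range_inner_apply (A : H →ₗ[ℝ] H) (W : Submodule ℝ H) :
    BddAbove (Set.range fun v : {v : H // v ∈ Wᗮ ∧ ‖v‖ ≤ 1} => inner ℝ v.1 (A v.1)) := by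
  refine ⟨‖LinearMap.toContinuousLinearMap A‖, ?_⟩
  rintro _ ⟨⟨v, hv, hv1⟩, rfl⟩
  refine (real_inner_le_norm _ _).trans ?_
  have h1 : ‖A v‖ ≤ ‖LinearMap.toContinuousLinearMap A‖ * ‖v‖ :=
    (LinearMap.toContinuousLinearMap A).le_opNorm v
  have := norm_nonneg (LinearMap.toContinuousLinearMap A)
  have h2 := norm_nonneg v
  have h3 := norm_nonneg (A v)
  nlinarith

theorem bddBelow_range_iSup_inner_apply (A : H →ₗ[ℝ] H) (l : ℕ) :
    BddBelow (Set.range fun W : {W : Submodule ℝ H // finrank ℝ W ≤ l} =>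
      ⨆ v : {v : H // v ∈ W.1ᗮ ∧ ‖v‖ ≤ 1}, inner ℝ v.1 (A v.1)) := by
  refine ⟨0, ?_⟩
  rintro _ ⟨W, rfl⟩
  exact le_ciSup_of_le (bddAbove_range_inner_apply A W) ⟨0, zero_mem _, by simp⟩ (by simp)

theorem minMax_le {A : H →ₗ[ℝ] H} {l : ℕ} {c : ℝ} (W : Submodule ℝ H) (hW : finrank ℝ W ≤ l)
    (h : ∀ v ∈ Wᗮ, ‖v‖ ≤ 1 → inner ℝ v (A v) ≤ c) : minMax A l ≤ c :=
  ciInf_le_of_le (bddBelow_range_iSup_inner_apply A l) ⟨W, hW⟩ (ciSup_le fun v => h v v.2.1 v.2.2)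

theorem le_minMax {A : H →ₗ[ℝ] H} {l : ℕ} {c : ℝ}
    (h : ∀ W : Submodule ℝ H, finrank ℝ W ≤ l → ∃ v ∈ Wᗮ, ‖v‖ ≤ 1 ∧ c ≤ inner ℝ v (A v)) :
    c ≤ minMax A l := by
  refine le_ciInf fun W => ?_
  obtain ⟨v, hv, hv1, hc⟩ := h W W.2
  exact le_ciSup_of_le (bddAbove_range_inner_apply A W) ⟨v, hv, hv1⟩ hc

theorem minMax_nonneg (A : H →ₗ[ℝ] H) (l : ℕ) : 0 ≤ minMax A l :=
  le_minMax fun W _ => ⟨0, zero_mem _, by simp, by simp⟩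

/-- The Courant–Fischer principle for singular values. -/
theorem sq_singularValues_eq_minMax (T : G →ₗ[ℝ] H) (l : ℕ) :
    T.singularValues l ^ 2 = minMax (T ∘ₗ LinearMap.adjoint T) l := by
  have hq : ∀ v, inner ℝ v ((T ∘ₗ LinearMap.adjoint T) v) = ‖LinearMap.adjoint T v‖ ^ 2 :=
    fun v => by
      rw [LinearMap.comp_apply, ← LinearMap.adjoint_inner_left, real_inner_self_eq_norm_sq]
  refine le_antisymm (le_minMax fun W hW => ?_) ?_
  · simpa only [hq] using exists_mem_orthogonal_le_norm_adjoint T l W hW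
  · obtain ⟨W, hW, h⟩ := exists_submodule_norm_adjoint_le T l
    refine minMax_le W hW fun v hv hv1 => ?_
    rw [hq]
    gcongr
    exact (h v hv).trans (mul_le_of_le_one_right (T.singularValues_nonneg l) hv1)

/-- Half of Weyl's perturbation inequality: for each `W` the suprema differ by at most `δ`, so no
control of eigenvectors is needed. -/
theorem minMax_le_add {A B : H →ₗ[ℝ] H} {δ : ℝ}
    (h : ∀ v, |inner ℝ v (A v) - inner ℝ v (B v)| ≤ δ * ‖v‖ ^ 2) (hδ : 0 ≤ δ) (l : ℕ) :
    minMax A l ≤ minMax B l + δ := by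
  rw [← sub_le_iff_le_add]
  refine le_ciInf fun W => ?_
  rw [sub_le_iff_le_add]
  refine minMax_le W.1 W.2 fun v hv hv1 => ?_
  have h1 : inner ℝ v (B v) ≤ ⨆ v : {v : H // v ∈ W.1ᗮ ∧ ‖v‖ ≤ 1}, inner ℝ v.1 (B v.1) :=
    le_ciSup (bddAbove_range_inner_apply B W) ⟨v, hv, hv1⟩
  have h2 := (le_abs_self _).trans (h v)
  have h3 : ‖v‖ ^ 2 ≤ 1 := pow_le_one₀ (norm_nonneg v) hv1
  nlinarith

theorem abs_minMax_sub_le {A B : H →ₗ[ℝ] H} {δ : ℝ}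
    (h : ∀ v, |inner ℝ v (A v) - inner ℝ v (B v)| ≤ δ * ‖v‖ ^ 2) (hδ : 0 ≤ δ) (l : ℕ) :
    |minMax A l - minMax B l| ≤ δ := by
  rw [abs_sub_le_iff]
  have h1 := minMax_le_add h hδ l
  have h2 := minMax_le_add (fun v => by rw [abs_sub_comm]; exact h v) hδ l
  constructor <;> linarith

/-- A subspace of dimension below that of `K` is orthogonal to some unit vector of `K`, which the
projection fixes. -/
theorem minMax_starProjection_of_lt (K : Submodule ℝ H) {l : ℕ} (hl : l < finrank ℝ K) :
    minMax K.starProjection.toLinearMap l = 1 := by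
  have hq : ∀ v, inner ℝ v (K.starProjection.toLinearMap v) = ‖K.starProjection v‖ ^ 2 :=
      fun v => by
    rw [ContinuousLinearMap.coe_coe, ← real_inner_self_eq_norm_sq,
      Submodule.inner_starProjection_left_eq_right,
      Submodule.starProjection_eq_self_iff.2 (K.starProjection_apply_mem v)]
  refine le_antisymm ?_ (le_minMax fun W hW => ?_)
  · refine minMax_le ⊥ (by simp) fun v _ hv => ?_
    rw [hq]
    exact pow_le_one₀ (norm_nonneg _) ((K.norm_starProjection_apply_le v).trans hv)
  · let Φ : K →ₗ[ℝ] W := W.orthogonalProjectionOnto.toLinearMap ∘ₗ K.subtype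
    obtain ⟨w, hw, hw0⟩ := (Submodule.ne_bot_iff _).1
      (LinearMap.ker_ne_bot_of_finrank_lt (f := Φ) (hW.trans_lt hl))
    have hwW : (w : H) ∈ Wᗮ := by
      have : W.orthogonalProjectionOnto (w : H) = 0 := hw
      exact Submodule.orthogonalProjectionOnto_eq_zero_iff.1 this
    have hpos : 0 < ‖(w : H)‖ := norm_pos_iff.2 fun h => hw0 (Subtype.ext h)
    have hnorm : ‖‖(w : H)‖⁻¹ • (w : H)‖ = 1 := by
      rw [norm_smul, norm_inv, norm_norm, inv_mul_cancel₀ hpos.ne']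
    refine ⟨‖(w : H)‖⁻¹ • (w : H), Submodule.smul_mem _ _ hwW, hnorm.le, ?_⟩
    rw [hq, Submodule.starProjection_eq_self_iff.2 (K.smul_mem _ w.2), hnorm, one_pow]

theorem minMax_starProjection_of_le (K : Submodule ℝ H) {l : ℕ} (hl : finrank ℝ K ≤ l) :
    minMax K.starProjection.toLinearMap l = 0 := by
  refine le_antisymm (minMax_le K hl fun v hv _ => ?_) (minMax_nonneg _ _)
  rw [ContinuousLinearMap.coe_coe, (Submodule.starProjection_apply_eq_zero_iff K).2 hv,
    inner_zero_right]

end MinMax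

/-! ### Local parametrizations -/

section Param

variable {m d : ℕ} {M : Set (EuclideanSpace ℝ (Fin m))} {U : Set (EuclideanSpace ℝ (Fin d))}
  {φ : EuclideanSpace ℝ (Fin d) → EuclideanSpace ℝ (Fin m)}

theorem IsLocalParam.image_subset (hφ : IsLocalParam M U φ) : φ '' U ⊆ M := by
  obtain ⟨W, -, hW⟩ := hφ.image_open U subset_rfl hφ.isOpen
  exact hW ▸ Set.inter_subset_left

theorem IsLocalParam.contDiffAt (hφ : IsLocalParam M U φ) {u : EuclideanSpace ℝ (Fin d)}
    (hu : u ∈ U) : ContDiffAt ℝ ∞ φ u :=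
  hφ.contDiffOn.contDiffAt (hφ.isOpen.mem_nhds hu)

theorem IsLocalParam.differentiableAt (hφ : IsLocalParam M U φ) {u : EuclideanSpace ℝ (Fin d)}
    (hu : u ∈ U) : DifferentiableAt ℝ φ u :=
  (hφ.contDiffAt hu).differentiableAt (by simp)

/-- An affine change of coordinates in a local parametrization. -/
theorem IsLocalParam.comp_affine (hφ : IsLocalParam M U φ)
    (B : EuclideanSpace ℝ (Fin d) ≃L[ℝ] EuclideanSpace ℝ (Fin d))
    (u₀ : EuclideanSpace ℝ (Fin d)) :
    IsLocalParam M ((fun u => u₀ + B u) ⁻¹' U) (fun u => φ (u₀ + B u)) where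
  isOpen := hφ.isOpen.preimage (by fun_prop)
  contDiffOn := hφ.contDiffOn.comp (by fun_prop : ContDiff ℝ ∞ fun u => u₀ + B u).contDiffOn
    fun _ hu => hu
  injOn u hu v hv huv := by
    have := hφ.injOn hu hv huv
    simpa using this
  injective_fderiv u hu := by
    have h1 : HasFDerivAt (fun u => u₀ + B u) (B : _ →L[ℝ] _) u :=
      B.hasFDerivAt.const_add u₀
    have h2 := (hφ.differentiableAt hu).hasFDerivAt.comp u h1
    rw [HasFDerivAt.fderiv (f := fun u => φ (u₀ + B u)) h2]
    exact (hφ.injective_fderiv _ hu).comp B.injective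
  image_open V hV hVo := by
    have hopen : IsOpen ((fun u => u₀ + B u) '' V) :=
      ((Homeomorph.addLeft u₀).isOpenMap.comp B.toHomeomorph.isOpenMap) V hVo
    obtain ⟨W, hW, h⟩ := hφ.image_open _ (Set.image_subset_iff.2 hV) hopen
    exact ⟨W, hW, by rw [← h, Set.image_image]⟩

/-- Around every point of a submanifold there is a parametrization whose derivative at the origin
is isometric. -/
theorem IsSubmanifold.exists_isometric_param (hM : IsSubmanifold d M)
    {x : EuclideanSpace ℝ (Fin m)} (hx : x ∈ M) :
    ∃ (U : Set (EuclideanSpace ℝ (Fin d)))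
      (φ : EuclideanSpace ℝ (Fin d) → EuclideanSpace ℝ (Fin m))
      (J : EuclideanSpace ℝ (Fin d) →ₗᵢ[ℝ] EuclideanSpace ℝ (Fin m)),
      IsLocalParam M U φ ∧ 0 ∈ U ∧ φ 0 = x ∧ HasFDerivAt φ J.toContinuousLinearMap 0 := by
  obtain ⟨U, φ, hφ, u₀, hu₀, rfl⟩ := hM x hx
  set A := fderiv ℝ φ u₀ with hA
  have hinj : Function.Injective A.toLinearMap := hφ.injective_fderiv u₀ hu₀
  let A' := LinearEquiv.ofInjective A.toLinearMap hinj
  have hdim : Module.finrank ℝ (LinearMap.range A.toLinearMap) = d := by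
    rw [← A'.finrank_eq]; simp
  let e := (stdOrthonormalBasis ℝ (LinearMap.range A.toLinearMap)).reindex (finCongr hdim)
  let J : EuclideanSpace ℝ (Fin d) →ₗᵢ[ℝ] EuclideanSpace ℝ (Fin m) :=
    (LinearMap.range A.toLinearMap).subtypeₗᵢ.comp e.repr.symm.toLinearIsometry
  -- `B` is `A⁻¹ J` on the range of `A`, so precomposing with `u₀ + B u` replaces the derivative `A`
  -- by the isometry `J`.
  let B : EuclideanSpace ℝ (Fin d) ≃L[ℝ] EuclideanSpace ℝ (Fin d) :=
    (e.repr.symm.toLinearEquiv.trans A'.symm).toContinuousLinearEquiv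
  have hAB : ∀ u, A (B u) = J u := fun u =>
    congrArg Subtype.val (A'.apply_symm_apply (e.repr.symm u))
  refine ⟨_, _, J, hφ.comp_affine B u₀, by simpa using hu₀, by simp, ?_⟩
  have h1 : HasFDerivAt (fun u => u₀ + B u) (B : _ →L[ℝ] _) 0 := B.hasFDerivAt.const_add u₀
  have h2 : HasFDerivAt φ A (u₀ + B 0) := by
    simpa [hA] using (hφ.differentiableAt hu₀).hasFDerivAt
  convert! h2.comp (0 : EuclideanSpace ℝ (Fin d)) h1 using 1
  ext1 u
  exact (hAB u).symm

variable {x : EuclideanSpace ℝ (Fin m)}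
  {J : EuclideanSpace ℝ (Fin d) →ₗᵢ[ℝ] EuclideanSpace ℝ (Fin m)}

/-- A curve in `M` through `φ 0` lifts continuously through a local parametrization. -/
theorem IsLocalParam.exists_lift (hφ : IsLocalParam M U φ) (h0 : 0 ∈ U)
    {γ : ℝ → EuclideanSpace ℝ (Fin m)} (hγ : ContinuousAt γ 0) (hγM : ∀ᶠ t in 𝓝 0, γ t ∈ M)
    (hγ0 : γ 0 = φ 0) :
    ∃ c : ℝ → EuclideanSpace ℝ (Fin d), Tendsto c (𝓝 0) (𝓝 0) ∧ ∀ᶠ t in 𝓝 0, φ (c t) = γ t := by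
  have key : ∀ V ⊆ U, IsOpen V → 0 ∈ V → ∀ᶠ t in 𝓝 0, ∃ v ∈ V, φ v = γ t := by
    intro V hVU hV h0V
    obtain ⟨W, hW, hVW⟩ := hφ.image_open V hVU hV
    have hxW : γ 0 ∈ W := by
      have : φ 0 ∈ M ∩ W := hVW ▸ Set.mem_image_of_mem φ h0V
      exact hγ0 ▸ this.2
    filter_upwards [hγM, hγ.eventually_mem (hW.mem_nhds hxW)] with t ht1 ht2
    have : γ t ∈ φ '' V := hVW ▸ ⟨ht1, ht2⟩
    exact this
  refine ⟨fun t => Function.invFunOn φ U (γ t), ?_, ?_⟩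
  · rw [tendsto_def]
    intro s hs
    obtain ⟨V, hVs, hV, h0V⟩ := mem_nhds_iff.1 (Filter.inter_mem hs (hφ.isOpen.mem_nhds h0))
    filter_upwards [key V (hVs.trans Set.inter_subset_right) hV h0V] with t ht
    obtain ⟨v, hv, hvt⟩ := ht
    have hvU : v ∈ U := (hVs hv).2
    have : Function.invFunOn φ U (γ t) = v := by
      rw [← hvt]; exact hφ.injOn.leftInvOn_invFunOn hvU
    rw [Set.mem_preimage, this]
    exact (hVs hv).1
  · filter_upwards [key U subset_rfl hφ.isOpen h0] with t ht
    exact Function.invFunOn_eq ht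

theorem IsLocalParam.tangentAt_eq_range (hφ : IsLocalParam M U φ) (h0 : 0 ∈ U) (hx : φ 0 = x)
    (hJ : HasFDerivAt φ J.toContinuousLinearMap 0) :
    tangentAt M x = LinearMap.range J.toLinearMap := by
  apply le_antisymm
  · refine Submodule.span_le.2 ?_
    rintro v ⟨γ, hγ, hγM, hγ0, rfl⟩
    obtain ⟨c, hc, hcγ⟩ := hφ.exists_lift h0 hγ.continuousAt hγM (hγ0.trans hx.symm)
    have hγd : HasDerivAt γ (deriv γ 0) 0 := (hγ.differentiableAt (by simp)).hasDerivAt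
    set K := LinearMap.range J.toLinearMap with hK
    have hlin : (fun t => γ t - x - J (c t)) =o[𝓝 0] c := by
      have := hJ.isLittleO.comp_tendsto hc
      refine this.congr' ?_ (Eventually.of_forall fun t => by simp)
      filter_upwards [hcγ] with t ht
      simp [ht, hx]
    -- The lift `c` is only known to be continuous. Because `‖J (c t)‖ = ‖c t‖`, the linearization
    -- error can be absorbed, and `c` is controlled by the curve.
    have hcO : c =O[𝓝 0] fun t => γ t - x := by
      refine IsBigO.of_bound 2 ?_
      filter_upwards [hlin.bound (show (0 : ℝ) < 1 / 2 by norm_num)] with t ht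
      have h1 : ‖c t‖ ≤ ‖γ t - x‖ + ‖γ t - x - J (c t)‖ := by
        rw [← J.norm_map (c t)]
        calc ‖J (c t)‖ = ‖(γ t - x) - (γ t - x - J (c t))‖ := by congr 1; abel
          _ ≤ _ := norm_sub_le _ _
      linarith
    have hγO : (fun t => γ t - x) =O[𝓝 0] fun t : ℝ => t := by
      simpa [hγ0] using hγd.isBigO_sub
    have hlin' : (fun t => γ t - x - J (c t)) =o[𝓝 0] fun t : ℝ => t :=
      hlin.trans_isBigO (hcO.trans hγO)
    -- Projecting to `Kᗮ` kills `J (c t)` and leaves only the error, so the normal component of the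
    -- velocity is zero.
    have hQ : (fun t => Kᗮ.starProjection (γ t - x)) =o[𝓝 0] fun t : ℝ => t := by
      refine ((Kᗮ.starProjection.isBigO_comp _ _).trans_isLittleO hlin').congr_left fun t => ?_
      have h1 : Kᗮ.starProjection (J (c t)) = 0 :=
        (Submodule.starProjection_apply_eq_zero_iff Kᗮ).2 (K.le_orthogonal_orthogonal ⟨c t, rfl⟩)
      rw [map_sub, h1, sub_zero]
    have hQd : HasDerivAt (fun t => Kᗮ.starProjection (γ t)) 0 0 := by
      rw [hasDerivAt_iff_isLittleO]
      refine hQ.congr (fun t => ?_) (fun t => by simp)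
      rw [map_sub, hγ0, smul_zero, sub_zero]
    have hzero : Kᗮ.starProjection (deriv γ 0) = 0 :=
      (Kᗮ.starProjection.hasFDerivAt.comp_hasDerivAt 0 hγd).unique hQd
    have := (Submodule.starProjection_apply_eq_zero_iff Kᗮ).1 hzero
    rwa [Submodule.orthogonal_orthogonal] at this
  · rintro _ ⟨w, rfl⟩
    refine Submodule.subset_span ⟨fun t => φ (t • w), ?_, ?_, by simp [hx], ?_⟩
    · have h1 : ContDiffAt ℝ ∞ (fun t : ℝ => t • w) 0 := by fun_prop
      have h2 : ContDiffAt ℝ ∞ φ ((0 : ℝ) • w) := by simpa using hφ.contDiffAt h0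
      exact h2.comp 0 h1
    · have h1 : Tendsto (fun t : ℝ => t • w) (𝓝 0) (𝓝 0) := by
        have : Continuous fun t : ℝ => t • w := by fun_prop
        simpa using this.tendsto 0
      filter_upwards [h1.eventually_mem (hφ.isOpen.mem_nhds h0)] with t ht
      exact hφ.image_subset ⟨_, ht, rfl⟩
    · have h1 : HasDerivAt (fun t : ℝ => t • w) w 0 := by
        simpa using (hasDerivAt_id (0 : ℝ)).smul_const w
      have h2 : HasFDerivAt φ J.toContinuousLinearMap ((0 : ℝ) • w) := by simpa using hJ
      exact (h2.comp_hasDerivAt (0 : ℝ) h1).deriv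

/-! ### The density in a local parametrization -/

/-- The density of `p dV` in the parametrization `φ`. -/
noncomputable def localDensity (p : EuclideanSpace ℝ (Fin m) → ℝ)
    (φ : EuclideanSpace ℝ (Fin d) → EuclideanSpace ℝ (Fin m)) (u : EuclideanSpace ℝ (Fin d)) : ℝ :=
  p (φ u) * √((metricMatrix φ u).det)

theorem metricMatrix_eq_one (hJ : HasFDerivAt φ J.toContinuousLinearMap 0) :
    metricMatrix φ 0 = 1 := by
  ext i j
  simp only [metricMatrix, Matrix.of_apply, hJ.fderiv, LinearIsometry.coe_toContinuousLinearMap,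
    J.inner_map_map, Matrix.one_apply]
  simp [EuclideanSpace.inner_single_left]

theorem contDiffAt_localDensity {p : EuclideanSpace ℝ (Fin m) → ℝ} (hp : ContDiffOn ℝ ∞ p M)
    (hφ : IsLocalParam M U φ) (h0 : 0 ∈ U) (hJ : HasFDerivAt φ J.toContinuousLinearMap 0) :
    ContDiffAt ℝ ∞ (localDensity p φ) 0 := by
  have h1 : ContDiffAt ℝ ∞ (fun u => p (φ u)) 0 :=
    (hp.comp hφ.contDiffOn fun u hu => hφ.image_subset ⟨u, hu, rfl⟩).contDiffAt
      (hφ.isOpen.mem_nhds h0)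
  have hd : ContDiffAt ℝ ∞ (fderiv ℝ φ) 0 := (hφ.contDiffAt h0).fderiv_right (by simp)
  have h2 : ContDiffAt ℝ ∞ (fun u => (metricMatrix φ u).det) 0 := by
    simp only [Matrix.det_apply', metricMatrix, Matrix.of_apply]
    refine ContDiffAt.sum fun τ _ => contDiffAt_const.mul (contDiffAt_prod fun i _ => ?_)
    exact (hd.clm_apply contDiffAt_const).inner ℝ (hd.clm_apply contDiffAt_const)
  refine h1.mul (h2.sqrt ?_)
  simp [metricMatrix_eq_one hJ]

theorem localDensity_zero (p : EuclideanSpace ℝ (Fin m) → ℝ) (hx : φ 0 = x)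
    (hJ : HasFDerivAt φ J.toContinuousLinearMap 0) : localDensity p φ 0 = p x := by
  simp [localDensity, metricMatrix_eq_one hJ, hx]

/-- The density hypothesis computes `P` on images `φ '' A`; since `P` is carried by `M` and `φ '' B
= M ∩ W`, this determines `P` on `W`. -/
theorem restrict_eq_map_localDensity {p : EuclideanSpace ℝ (Fin m) → ℝ}
    {P : Measure (EuclideanSpace ℝ (Fin m))} (hP : HasVolumeDensity d M p P)
    (hφ : IsLocalParam M U φ) {B : Set (EuclideanSpace ℝ (Fin d))} (hB : IsOpen B) (hBU : B ⊆ U)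
    {W : Set (EuclideanSpace ℝ (Fin m))} (hW : φ '' B = M ∩ W) :
    P.restrict W =
      ((volume.restrict B).withDensity fun u => ENNReal.ofReal (localDensity p φ u)).map φ := by
  have hc : ContinuousOn φ B := hφ.contDiffOn.continuousOn.mono hBU
  have hmeas : AEMeasurable φ
      ((volume.restrict B).withDensity fun u => ENNReal.ofReal (localDensity p φ u)) :=
    (hc.aemeasurable hB.measurableSet).mono_ac (withDensity_absolutelyContinuous _ _)
  ext S hS
  -- Off its domain `φ` may be non-measurable, so measurability comes from continuity on the subtype
  -- `B`.
  have hmS : MeasurableSet (φ ⁻¹' S ∩ B) := by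
    have h1 := (continuousOn_iff_continuous_domRestrict.1 hc).measurable hS
    have h2 := hB.measurableSet.subtype_image h1
    convert h2 using 1
    ext u
    simp [and_comm]
  rw [Measure.restrict_apply hS, Measure.map_apply_of_aemeasurable hmeas hS,
    withDensity_apply' _ _, Measure.restrict_restrict' hB.measurableSet]
  have h3 := hP.2 U φ hφ (φ ⁻¹' S ∩ B) (Set.inter_subset_right.trans hBU) hmS
  have h4 : φ '' (φ ⁻¹' S ∩ B) = (S ∩ W) ∩ M := by
    rw [Set.image_preimage_inter, hW]
    ext y; simp only [Set.mem_inter_iff]; tauto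
  rw [h4, measure_inter_conull hP.1] at h3
  exact h3

theorem setIntegral_eq_integral_localDensity {p : EuclideanSpace ℝ (Fin m) → ℝ}
    (hp0 : ∀ y ∈ M, 0 ≤ p y)
    {P : Measure (EuclideanSpace ℝ (Fin m))} (hP : HasVolumeDensity d M p P)
    (hφ : IsLocalParam M U φ) {B : Set (EuclideanSpace ℝ (Fin d))} (hB : IsOpen B) (hBU : B ⊆ U)
    (hq : ContinuousOn (localDensity p φ) B)
    {W : Set (EuclideanSpace ℝ (Fin m))} (hW : φ '' B = M ∩ W)
    {f : EuclideanSpace ℝ (Fin m) → ℝ} (hf : Continuous f) :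
    ∫ y in W, f y ∂P = ∫ u in B, localDensity p φ u * f (φ u) := by
  have hc : ContinuousOn φ B := hφ.contDiffOn.continuousOn.mono hBU
  have hmeas : AEMeasurable φ
      ((volume.restrict B).withDensity fun u => ENNReal.ofReal (localDensity p φ u)) :=
    (hc.aemeasurable hB.measurableSet).mono_ac (withDensity_absolutelyContinuous _ _)
  rw [restrict_eq_map_localDensity hP hφ hB hBU hW,
    integral_map hmeas hf.aestronglyMeasurable,
    integral_withDensity_eq_integral_toReal_smul₀
      (hq.aemeasurable hB.measurableSet).ennreal_ofReal (by simp)]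
  refine setIntegral_congr_fun hB.measurableSet fun u hu => ?_
  have : 0 ≤ localDensity p φ u :=
    mul_nonneg (hp0 _ (hφ.image_subset ⟨u, hBU hu, rfl⟩)) (Real.sqrt_nonneg _)
  simp [ENNReal.toReal_ofReal this]

end Param

/-! ### Expansion of Gaussian-weighted integrals on a submanifold -/

section Expansion

variable {m d : ℕ} {M : Set (EuclideanSpace ℝ (Fin m))} {U : Set (EuclideanSpace ℝ (Fin d))}
  {φ : EuclideanSpace ℝ (Fin d) → EuclideanSpace ℝ (Fin m)} {x : EuclideanSpace ℝ (Fin m)}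
  {J : EuclideanSpace ℝ (Fin d) →ₗᵢ[ℝ] EuclideanSpace ℝ (Fin m)}

theorem IsLocalParam.sub_sub_isBigO (hφ : IsLocalParam M U φ) (h0 : 0 ∈ U) (hx : φ 0 = x)
    (hJ : HasFDerivAt φ J.toContinuousLinearMap 0) :
    (fun u => φ u - x - J u) =O[𝓝 0] fun u => ‖u‖ ^ 2 := by
  have hdiff : ∀ᶠ u in 𝓝 0, DifferentiableAt ℝ φ u := by
    filter_upwards [hφ.isOpen.mem_nhds h0] with u hu using hφ.differentiableAt hu
  have hfd : ∀ᶠ u in 𝓝 0, HasFDerivAt (fun u => φ u - J u)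
      (fderiv ℝ φ u - J.toContinuousLinearMap) u := by
    filter_upwards [hdiff] with u hu
    exact hu.hasFDerivAt.sub J.toContinuousLinearMap.hasFDerivAt
  have h2 : DifferentiableAt ℝ (fderiv ℝ φ) 0 :=
    ((hφ.contDiffAt h0).fderiv_right (m := ∞) (by simp)).differentiableAt (by simp)
  have h3 : fderiv ℝ (fun u => φ u - J u) =O[𝓝 0] fun u => ‖u‖ ^ 1 := by
    refine IsBigO.trans (h2.isBigO_sub.congr' ?_ EventuallyEq.rfl)
      (IsBigO.of_bound 1 (Eventually.of_forall fun u => by simp))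
    filter_upwards [hfd] with u hu
    rw [hu.fderiv, hJ.fderiv]
  have := isBigO_sub_of_fderiv_isBigO (hfd.mono fun u hu => hu.differentiableAt) h3
  refine this.congr_left fun u => ?_
  simp [hx]; abel

theorem linearIsometry_isBigO_norm {V W : Type*} [NormedAddCommGroup V] [NormedSpace ℝ V]
    [NormedAddCommGroup W] [NormedSpace ℝ W] (J : V →ₗᵢ[ℝ] W) (l : Filter V) :
    (fun u => J u) =O[l] fun u => ‖u‖ ^ 1 :=
  IsBigO.of_bound 1 (Eventually.of_forall fun u => by simp)

theorem IsLocalParam.sub_isBigO (hφ : IsLocalParam M U φ) (h0 : 0 ∈ U) (hx : φ 0 = x)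
    (hJ : HasFDerivAt φ J.toContinuousLinearMap 0) :
    (fun u => φ u - x) =O[𝓝 0] fun u => ‖u‖ ^ 1 :=
  (((hφ.sub_sub_isBigO h0 hx hJ).trans (norm_pow_isBigO_norm_pow (by norm_num))).add
    (linearIsometry_isBigO_norm J _)).congr_left fun u => by abel

theorem isBigO_inner {α E : Type*} [NormedAddCommGroup E] [InnerProductSpace ℝ E] {l : Filter α}
    {f g : α → E} {f' g' : α → ℝ} (hf : f =O[l] f') (hg : g =O[l] g') :
    (fun a => inner ℝ (f a) (g a)) =O[l] fun a => f' a * g' a := by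
  refine IsBigO.trans ?_ (hf.norm_left.mul hg.norm_left)
  exact IsBigO.of_bound 1 (Eventually.of_forall fun a => by
    simpa using abs_real_inner_le_norm (f a) (g a))

/-- The difference between the squared distance in `ℝᵐ` and in the parameter domain. -/
theorem IsLocalParam.norm_sq_sub_norm_sq_isBigO (hφ : IsLocalParam M U φ) (h0 : 0 ∈ U)
    (hx : φ 0 = x) (hJ : HasFDerivAt φ J.toContinuousLinearMap 0) :
    (fun u => ‖φ u - x‖ ^ 2 - ‖u‖ ^ 2) =O[𝓝 0] fun u => ‖u‖ ^ 3 := by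
  -- Difference of squares: `‖a‖² - ‖J u‖² = ⟪a - J u, a + J u⟫` with `a = φ u - x`, of orders `2`
  -- and `1`.
  have h := isBigO_inner (hφ.sub_sub_isBigO h0 hx hJ)
    ((hφ.sub_isBigO h0 hx hJ).add (linearIsometry_isBigO_norm J _))
  refine h.congr (fun u => ?_) (fun u => by ring)
  rw [inner_sub_left, inner_add_right, inner_add_right, real_inner_self_eq_norm_sq,
    real_inner_self_eq_norm_sq, J.norm_map, real_inner_comm (J u)]
  ring

theorem norm_pow_mul_gauss_le {V : Type*} [NormedAddCommGroup V] {ε : ℝ} (hε : 0 < ε) (y : V)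
    (n : ℕ) : ‖y‖ ^ (2 * n) * gauss ε y ≤ n.factorial * (2 * ε) ^ n := by
  have h := Real.pow_div_factorial_le_exp (x := ‖y‖ ^ 2 / (2 * ε)) (by positivity) n
  rw [div_pow, div_div, div_le_iff₀ (by positivity)] at h
  rw [gauss, neg_div, Real.exp_neg, ← div_eq_mul_inv, div_le_iff₀ (Real.exp_pos _), pow_mul]
  linarith

/-- The part of a Gaussian-weighted integral away from the centre is negligible. -/
theorem setIntegral_mul_gauss_compl_isBigO {E : Type*} [NormedAddCommGroup E]
    [MeasurableSpace E] [BorelSpace E] {P : Measure E} [IsProbabilityMeasure P] {W : Set E} {x : E}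
    (hW : W ∈ 𝓝 x) {f : E → ℝ} {C : ℝ} {a : ℕ} (hC0 : 0 ≤ C)
    (hC : ∀ y, ‖f y‖ ≤ C * ‖y - x‖ ^ (2 * a)) (n : ℕ) :
    (fun ε : ℝ => ∫ y in Wᶜ, f y * gauss ε (y - x) ∂P) =O[𝓝[>] 0]
      fun ε : ℝ => ε ^ (a + n) := by
  obtain ⟨ρ, hρ, hball⟩ := Metric.mem_nhds_iff.1 hW
  refine IsBigO.of_bound (C * (a + n).factorial * 2 ^ (a + n) / ρ ^ (2 * n)) ?_
  filter_upwards [self_mem_nhdsWithin] with ε hε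
  have hε : 0 < ε := hε
  have hbound : ∀ y ∈ Wᶜ, ‖f y * gauss ε (y - x)‖ ≤
      C * (a + n).factorial * 2 ^ (a + n) / ρ ^ (2 * n) * ε ^ (a + n) := by
    intro y hy
    have hρy : ρ ≤ ‖y - x‖ := by
      by_contra! h
      exact hy (hball (by simpa [dist_eq_norm] using h))
    have hpos : 0 < ‖y - x‖ := hρ.trans_le hρy
    have hg := (gauss_pos ε (y - x)).le
    rw [norm_mul, Real.norm_of_nonneg hg]
    have hle : gauss ε (y - x) ≤
        (a + n).factorial * (2 * ε) ^ (a + n) / ‖y - x‖ ^ (2 * (a + n)) := by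
      rw [le_div_iff₀ (by positivity), mul_comm]
      exact norm_pow_mul_gauss_le hε _ _
    calc ‖f y‖ * gauss ε (y - x) ≤ (C * ‖y - x‖ ^ (2 * a)) *
          ((a + n).factorial * (2 * ε) ^ (a + n) / ‖y - x‖ ^ (2 * (a + n))) := by
          gcongr
          exact hC y
      _ = C * (a + n).factorial * 2 ^ (a + n) * ε ^ (a + n) / ‖y - x‖ ^ (2 * n) := by
          rw [mul_add, pow_add ‖y - x‖, mul_pow]; field_simp
      _ ≤ C * (a + n).factorial * 2 ^ (a + n) * ε ^ (a + n) / ρ ^ (2 * n) := by gcongr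
      _ = _ := by ring
  refine (norm_setIntegral_le_of_norm_le_const (measure_lt_top P _) hbound).trans ?_
  rw [Real.norm_of_nonneg (by positivity)]
  exact mul_le_of_le_one_right (by positivity) measureReal_le_one

/-- The Gaussian makes polynomially growing integrands bounded, so no moment assumption on `P` is
needed. -/
theorem integrable_mul_gauss_sub {E : Type*} [NormedAddCommGroup E]
    [SecondCountableTopology E] [MeasurableSpace E] [BorelSpace E] {P : Measure E} [IsProbabilityMeasure P] {x : E}
    {f : E → ℝ} (hf : Continuous f) {C : ℝ} {a : ℕ} (hC0 : 0 ≤ C)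
    (hC : ∀ y, ‖f y‖ ≤ C * ‖y - x‖ ^ (2 * a)) {ε : ℝ} (hε : 0 < ε) :
    Integrable (fun y => f y * gauss ε (y - x)) P := by
  have hcont : Continuous fun y => f y * gauss ε (y - x) :=
    hf.mul ((continuous_gauss ε).comp (continuous_id.sub continuous_const))
  refine Integrable.of_bound hcont.aestronglyMeasurable (C * (a.factorial * (2 * ε) ^ a))
    (Eventually.of_forall fun y => ?_)
  have hg := (gauss_pos ε (y - x)).le
  rw [norm_mul, Real.norm_of_nonneg hg]
  calc ‖f y‖ * gauss ε (y - x) ≤ C * ‖y - x‖ ^ (2 * a) * gauss ε (y - x) := by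
        gcongr; exact hC y
    _ ≤ _ := by
        rw [mul_assoc]
        exact mul_le_mul_of_nonneg_left (norm_pow_mul_gauss_le hε _ _) hC0

/-- The small-bandwidth expansion of a Gaussian-weighted integral against `p dV`. -/
theorem IsLocalParam.integral_mul_gauss_expansion {p : EuclideanSpace ℝ (Fin m) → ℝ}
    (hp : ContDiffOn ℝ ∞ p M) (hp0 : ∀ y ∈ M, 0 ≤ p y)
    {P : Measure (EuclideanSpace ℝ (Fin m))} [IsProbabilityMeasure P]
    (hP : HasVolumeDensity d M p P) (hφ : IsLocalParam M U φ) (h0 : 0 ∈ U)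
    (hx : φ 0 = x) (hJ : HasFDerivAt φ J.toContinuousLinearMap 0)
    {f : EuclideanSpace ℝ (Fin m) → ℝ} (hf : ContDiff ℝ ∞ f) {C : ℝ} {a : ℕ} (hC0 : 0 ≤ C)
    (hC : ∀ y, ‖f y‖ ≤ C * ‖y - x‖ ^ (2 * a))
    {h₀ : EuclideanSpace ℝ (Fin d) → ℝ} (hh₀ : ContDiff ℝ ∞ h₀) {C₀ : ℝ}
    (hC₀ : ∀ u, ‖h₀ u‖ ≤ C₀ * ‖u‖ ^ (2 * a))
    (hhom : ∀ (t : ℝ) u, h₀ (t • u) = t ^ (2 * a) • h₀ u)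
    (hdiff : (fun u => f (φ u) - h₀ u) =O[𝓝 0] fun u => ‖u‖ ^ (2 * a + 1)) :
    ∃ c : ℝ, (fun ε : ℝ => (∫ y, f y * gauss ε (y - x) ∂P) -
      √ε ^ d * (ε ^ a * (p x * ∫ u, h₀ u * gauss 1 u) + c * ε ^ (a + 1)))
      =O[𝓝[>] 0] fun ε : ℝ => √ε ^ d * ε ^ (a + 2) := by
  set q := localDensity p φ with hq
  have hqs : ContDiffAt ℝ ∞ q 0 := contDiffAt_localDensity hp hφ h0 hJ
  have hq0 : q 0 = p x := localDensity_zero p hx hJ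
  have hφs := hφ.contDiffAt h0
  have hhs : ContDiffAt ℝ ∞ (fun u => q u * f (φ u)) 0 :=
    hqs.mul (hf.contDiffAt.comp 0 hφs)
  have hκs : ContDiffAt ℝ ∞ (fun u => ‖φ u - x‖ ^ 2 - ‖u‖ ^ 2) 0 :=
    ((hφs.sub contDiffAt_const).norm_sq ℝ).sub (contDiffAt_id.norm_sq ℝ)
  have hh₀O : h₀ =O[𝓝 0] fun u => ‖u‖ ^ (2 * a) :=
    IsBigO.of_bound C₀ (Eventually.of_forall fun u => by simpa using hC₀ u)
  have hdiff' : (fun u => q u * f (φ u) - p x * h₀ u) =O[𝓝 0] fun u => ‖u‖ ^ (2 * a + 1) := by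
    have h1 : (fun u => q u - q 0) =O[𝓝 0] fun u => ‖u‖ := by
      simpa using (hqs.differentiableAt (by simp)).isBigO_sub.norm_right
    have h2 := (hqs.continuousAt.isBigO_one ℝ).mul hdiff
    refine ((h2.congr_right fun u => one_mul _).add
      ((hh₀O.mul h1).congr_right fun u => (pow_succ _ _).symm)).congr_left fun u => ?_
    rw [hq0]; ring
  have hlap := laplace_expansion hhs (contDiff_const.mul hh₀) hκs a (C₀ := |p x| * C₀)
    (fun u => by
      rw [norm_mul, Real.norm_eq_abs (p x), mul_assoc]
      exact mul_le_mul_of_nonneg_left (hC₀ u) (abs_nonneg _))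
    (fun t u => by rw [hhom, smul_eq_mul, smul_eq_mul]; ring) hdiff'
    (hφ.norm_sq_sub_norm_sq_isBigO h0 hx hJ)
  -- One radius serves the Laplace expansion, the continuity of the density and containment in the
  -- chart.
  obtain ⟨r, ⟨c, hc⟩, hrq, hrU, hr⟩ := (hlap.and ((eventually_continuousOn_closedBall hqs).and
    ((eventually_forall_closedBall (hφ.isOpen.mem_nhds h0)).and self_mem_nhdsWithin))).exists
  have hr : 0 < r := hr
  have hBU : Metric.ball 0 r ⊆ U := fun u hu => hrU u (Metric.ball_subset_closedBall hu)
  obtain ⟨W, hWo, hW⟩ := hφ.image_open _ hBU Metric.isOpen_ball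
  have hxW : x ∈ W := by
    have : φ 0 ∈ M ∩ W := hW ▸ Set.mem_image_of_mem φ (Metric.mem_ball_self hr)
    exact hx ▸ this.2
  refine ⟨c, ?_⟩
  have htail : (fun ε : ℝ => ∫ y in Wᶜ, f y * gauss ε (y - x) ∂P) =O[𝓝[>] 0]
      fun ε : ℝ => √ε ^ d * ε ^ (a + 2) := by
    -- The tail has every power of `ε`; `d` spare ones suffice, as `ε ≤ √ε` for `ε < 1` gives `ε ^ d
    -- ≤ √ε ^ d`.
    refine (setIntegral_mul_gauss_compl_isBigO (hWo.mem_nhds hxW) hC0 hC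
      (d + 2)).trans (IsBigO.of_bound 1 ?_)
    filter_upwards [Ioo_mem_nhdsGT one_pos] with ε hε
    have hε0 : 0 < ε := hε.1
    rw [Real.norm_of_nonneg (by positivity), Real.norm_of_nonneg (by positivity), one_mul,
      show a + (d + 2) = d + (a + 2) by ring, pow_add]
    gcongr
    exact Real.le_sqrt_of_sq_le (by nlinarith [hε.2])
  simp only [finrank_euclideanSpace, Fintype.card_fin, mul_assoc (p x), integral_const_mul] at hc
  refine (hc.add htail).congr' ?_ EventuallyEq.rfl
  filter_upwards [self_mem_nhdsWithin] with ε hε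
  have hε : 0 < ε := hε
  rw [← integral_add_compl hWo.measurableSet
    (integrable_mul_gauss_sub (P := P) hf.continuous hC0 hC hε),
    setIntegral_eq_integral_localDensity hp0 hP hφ Metric.isOpen_ball hBU
      (hrq.mono Metric.ball_subset_closedBall) hW (f := fun y => f y * gauss ε (y - x))
      (hf.continuous.mul ((continuous_gauss ε).comp (continuous_id.sub continuous_const)))]
  have : ∀ u, q u * f (φ u) * Real.exp (-(‖u‖ ^ 2 + (‖φ u - x‖ ^ 2 - ‖u‖ ^ 2)) / (2 * ε)) =
      q u * (f (φ u) * gauss ε (φ u - x)) := fun u => by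
    rw [gauss, add_sub_cancel, mul_assoc]
  simp only [this]
  ring

end Expansion

/-! ### The expansion of the second moment matrix -/

section Moments

variable {m d : ℕ} {M : Set (EuclideanSpace ℝ (Fin m))} {U : Set (EuclideanSpace ℝ (Fin d))}
  {φ : EuclideanSpace ℝ (Fin d) → EuclideanSpace ℝ (Fin m)} {x : EuclideanSpace ℝ (Fin m)}
  {J : EuclideanSpace ℝ (Fin d) →ₗᵢ[ℝ] EuclideanSpace ℝ (Fin m)}

theorem isBigO_coord {α ι : Type*} [Fintype ι] {l : Filter α} {f : α → EuclideanSpace ℝ ι}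
    {g : α → ℝ} (hf : f =O[l] g) (i : ι) : (fun a => f a i) =O[l] g :=
  (IsBigO.of_bound 1 (Eventually.of_forall fun a => by
    simpa using PiLp.norm_apply_le (f a) i)).trans hf

theorem norm_coord_mul_coord_le {ι : Type*} [Fintype ι] (v : EuclideanSpace ℝ ι) (i k : ι) :
    ‖v i * v k‖ ≤ 1 * ‖v‖ ^ (2 * 1) := by
  rw [norm_mul, one_mul, mul_one, sq]
  exact mul_le_mul (PiLp.norm_apply_le v i) (PiLp.norm_apply_le v k) (norm_nonneg _)
    (norm_nonneg _)

theorem coord_eq_inner {ι : Type*} [Fintype ι] [DecidableEq ι] (v : EuclideanSpace ℝ ι) (i : ι) :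
    v i = inner ℝ (EuclideanSpace.single i (1 : ℝ)) v := by
  simp [EuclideanSpace.inner_single_left]

/-- The Gaussian second moments of an isometric embedding form the projection onto its range. -/
theorem integral_coord_mul_coord_mul_gauss
    (J : EuclideanSpace ℝ (Fin d) →ₗᵢ[ℝ] EuclideanSpace ℝ (Fin m)) (i k : Fin m) :
    ∫ u, (J u i * J u k) * gauss 1 u =
      ((LinearMap.range J.toLinearMap).starProjection (EuclideanSpace.single k 1)) i *
        ∫ u : EuclideanSpace ℝ (Fin d), gauss 1 u := by
  set K := LinearMap.range J.toLinearMap with hK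
  have hex : ∀ i : Fin m, ∃ a, J a = K.starProjection (EuclideanSpace.single i 1) := fun i =>
    K.starProjection_apply_mem _
  choose a ha using hex
  have hcoord : ∀ i u, J u i = inner ℝ (a i) u := fun i u => by
    rw [← J.inner_map_map, ha, Submodule.inner_starProjection_left_eq_right,
      Submodule.starProjection_eq_self_iff.2 (show J u ∈ K from ⟨u, rfl⟩), coord_eq_inner]
  simp only [hcoord]
  rw [integral_inner_mul_inner_mul_gauss, ← J.inner_map_map, ha, ha,
    Submodule.inner_starProjection_left_eq_right,
    Submodule.starProjection_eq_self_iff.2 (K.starProjection_apply_mem _), ← coord_eq_inner]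

theorem IsLocalParam.degree_expansion {p : EuclideanSpace ℝ (Fin m) → ℝ}
    (hp : ContDiffOn ℝ ∞ p M) (hp0 : ∀ y ∈ M, 0 ≤ p y)
    {P : Measure (EuclideanSpace ℝ (Fin m))} [IsProbabilityMeasure P]
    (hP : HasVolumeDensity d M p P) (hφ : IsLocalParam M U φ) (h0 : 0 ∈ U)
    (hx : φ 0 = x) (hJ : HasFDerivAt φ J.toContinuousLinearMap 0) :
    ∃ c : ℝ, (fun ε : ℝ => (∫ y, gauss ε (y - x) ∂P) -
      √ε ^ d * (p x * (∫ u : EuclideanSpace ℝ (Fin d), gauss 1 u) + c * ε))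
      =O[𝓝[>] 0] fun ε : ℝ => √ε ^ d * ε ^ 2 := by
  simpa using hφ.integral_mul_gauss_expansion hp hp0 hP h0 hx hJ (f := fun _ => 1) (a := 0)
    contDiff_const zero_le_one (by simp) (h₀ := fun _ => 1) contDiff_const (C₀ := 1) (by simp)
    (by simp) (by simpa using isBigO_zero _ _)

theorem IsLocalParam.moment_expansion {p : EuclideanSpace ℝ (Fin m) → ℝ}
    (hp : ContDiffOn ℝ ∞ p M) (hp0 : ∀ y ∈ M, 0 ≤ p y)
    {P : Measure (EuclideanSpace ℝ (Fin m))} [IsProbabilityMeasure P]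
    (hP : HasVolumeDensity d M p P) (hφ : IsLocalParam M U φ) (h0 : 0 ∈ U)
    (hx : φ 0 = x) (hJ : HasFDerivAt φ J.toContinuousLinearMap 0)
    {K : Submodule ℝ (EuclideanSpace ℝ (Fin m))} (hK : K = LinearMap.range J.toLinearMap)
    (i k : Fin m) :
    ∃ c : ℝ, (fun ε : ℝ => (∫ y, ((y - x) i * (y - x) k) * gauss ε (y - x) ∂P) -
      √ε ^ d * (ε * ((K.starProjection (EuclideanSpace.single k 1)) i *
          (p x * ∫ u : EuclideanSpace ℝ (Fin d), gauss 1 u)) + c * ε ^ 2))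
      =O[𝓝[>] 0] fun ε : ℝ => √ε ^ d * ε ^ 3 := by
  subst hK
  have hs : ∀ i : Fin m, ContDiff ℝ ∞ fun v : EuclideanSpace ℝ (Fin m) => v i := fun i =>
    contDiff_piLp_apply 2
  have hJs : ContDiff ℝ ∞ fun u => J u := J.toContinuousLinearMap.contDiff
  obtain ⟨c, hc⟩ := hφ.integral_mul_gauss_expansion hp hp0 hP h0 hx hJ
    (f := fun y => (y - x) i * (y - x) k) (a := 1)
    (((hs i).comp (contDiff_id.sub contDiff_const)).mul
      ((hs k).comp (contDiff_id.sub contDiff_const)))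
    zero_le_one (fun y => norm_coord_mul_coord_le _ _ _)
    (h₀ := fun u => J u i * J u k) (((hs i).comp hJs).mul ((hs k).comp hJs)) (C₀ := 1)
    (fun u => by simpa using norm_coord_mul_coord_le (J u) i k)
    (fun t u => by simp only [map_smul, PiLp.smul_apply, smul_eq_mul]; ring) (by
      have e1 := hφ.sub_sub_isBigO h0 hx hJ
      have e2 := hφ.sub_isBigO h0 hx hJ
      have e3 := linearIsometry_isBigO_norm J (𝓝 0)
      -- The splitting `ab - a₀b₀ = (a - a₀) b + a₀ (b - b₀)`, each product being of order `2 + 1`.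
      refine (((isBigO_coord e1 i).mul (isBigO_coord e2 k)).add
        (((isBigO_coord e3 i).mul (isBigO_coord e1 k)).congr_right fun u => mul_comm _ _)).congr
        (fun u => ?_) (fun u => by ring)
      simp only [PiLp.sub_apply]; ring)
  refine ⟨c, ?_⟩
  rw [integral_coord_mul_coord_mul_gauss] at hc
  refine hc.congr_left fun ε => ?_
  ring

/-- Division of two expansions. -/
theorem ratio_expansion {D S : ℝ → ℝ} {g c₁ c₂ π : ℝ} {d : ℕ} (hg : 0 < g)
    (hD : (fun ε : ℝ => D ε - √ε ^ d * (g + c₁ * ε)) =O[𝓝[>] 0] fun ε : ℝ => √ε ^ d * ε ^ 2)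
    (hS : (fun ε : ℝ => S ε - √ε ^ d * (ε * (π * g) + c₂ * ε ^ 2)) =O[𝓝[>] 0]
      fun ε : ℝ => √ε ^ d * ε ^ 3) :
    (fun ε : ℝ => S ε / (ε * D ε) - (π + ε * ((c₂ - c₁ * π) / g))) =O[𝓝[>] 0]
      fun ε : ℝ => ε ^ 2 := by
  set R := (c₂ - c₁ * π) / g with hR
  have hgR : g * R = c₂ - c₁ * π := by rw [hR]; field_simp
  have hcont : ∀ {f : ℝ → ℝ}, Continuous f → f =O[𝓝[>] 0] fun _ : ℝ => (1 : ℝ) := fun hf =>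
    ((hf.tendsto 0).isBigO_one ℝ).mono nhdsWithin_le_nhds
  have hpos : ∀ ε : ℝ, 0 < ε → 0 < √ε ^ d := fun ε hε => pow_pos (Real.sqrt_pos.2 hε) _
  set A : ℝ → ℝ := fun ε => (√ε ^ d)⁻¹ * D ε with hA
  set b : ℝ → ℝ := fun ε => (√ε ^ d * ε)⁻¹ * S ε with hb
  have hA' : (fun ε => A ε - (g + c₁ * ε)) =O[𝓝[>] 0] fun ε : ℝ => ε ^ 2 := by
    refine ((isBigO_refl (fun ε : ℝ => (√ε ^ d)⁻¹) _).mul hD).congr' ?_ ?_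
    · filter_upwards [self_mem_nhdsWithin] with ε hε
      have := hpos ε hε
      simp only [hA]; field_simp
    · filter_upwards [self_mem_nhdsWithin] with ε hε
      have := hpos ε hε
      field_simp
  have hb' : (fun ε => b ε - (π * g + c₂ * ε)) =O[𝓝[>] 0] fun ε : ℝ => ε ^ 2 := by
    refine ((isBigO_refl (fun ε : ℝ => (√ε ^ d * ε)⁻¹) _).mul hS).congr' ?_ ?_
    · filter_upwards [self_mem_nhdsWithin] with ε hε
      have := hpos ε hε
      have hε : 0 < ε := hε
      simp only [hb]; field_simp
    · filter_upwards [self_mem_nhdsWithin] with ε hε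
      have := hpos ε hε
      have hε : 0 < ε := hε
      field_simp
  have hAlim : Tendsto A (𝓝[>] 0) (𝓝 g) := by
    have h1 : Tendsto (fun ε : ℝ => ε ^ 2) (𝓝[>] 0) (𝓝 0) := by
      have : Continuous fun ε : ℝ => ε ^ 2 := by fun_prop
      simpa using (this.tendsto 0).mono_left nhdsWithin_le_nhds
    have h2 : Tendsto (fun ε : ℝ => g + c₁ * ε) (𝓝[>] 0) (𝓝 g) := by
      have : Continuous fun ε : ℝ => g + c₁ * ε := by fun_prop
      simpa using (this.tendsto 0).mono_left nhdsWithin_le_nhds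
    simpa using (hA'.trans_tendsto h1).add h2
  have hAinv : (fun ε => (A ε)⁻¹) =O[𝓝[>] 0] fun _ : ℝ => (1 : ℝ) :=
    (hAlim.inv₀ hg.ne').isBigO_one ℝ
  -- After cross-multiplication the terms in `ε` cancel by the choice `g R = c₂ - c₁ π`.
  have hnum : (fun ε => b ε - A ε * (π + ε * R)) =O[𝓝[>] 0] fun ε : ℝ => ε ^ 2 := by
    have h1 := (hA'.mul (hcont (f := fun ε => π + ε * R) (by fun_prop)))
    have h2 : (fun ε : ℝ => (c₁ * R) * ε ^ 2) =O[𝓝[>] 0] fun ε : ℝ => ε ^ 2 :=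
      (isBigO_refl _ _).const_mul_left _
    refine ((hb'.sub (h1.congr_right fun ε => mul_one _)).sub h2).congr_left fun ε => ?_
    linear_combination ε * hgR
  refine (hAinv.mul hnum).congr' ?_ (Eventually.of_forall fun ε => one_mul _)
  filter_upwards [self_mem_nhdsWithin, hAlim.eventually_ne hg.ne'] with ε hε hAε
  have hε : 0 < ε := hε
  have hp := hpos ε hε
  have hDε : D ε ≠ 0 := fun h => hAε (by simp [hA, h])
  rw [mul_sub, inv_mul_cancel_left₀ hAε]
  congr 1
  simp only [hA, hb]
  field_simp

end Moments

/-! ### Matrices as operators on Euclidean space -/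

section Matrices

variable {m d : ℕ}

theorem ofLp_toEuclideanLin {k n : ℕ} (A : Matrix (Fin k) (Fin n) ℝ)
    (v : EuclideanSpace ℝ (Fin n)) : (A.toEuclideanLin v).ofLp = A *ᵥ v.ofLp := rfl

theorem inner_toEuclideanLin (A : Matrix (Fin m) (Fin m) ℝ) (v : EuclideanSpace ℝ (Fin m)) :
    inner ℝ v (A.toEuclideanLin v) = v.ofLp ⬝ᵥ (A *ᵥ v.ofLp) := by
  rw [EuclideanSpace.inner_eq_star_dotProduct, ofLp_toEuclideanLin, dotProduct_comm]
  simp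

theorem dotProduct_mulVec_eq_sum (A : Matrix (Fin m) (Fin m) ℝ) (v : Fin m → ℝ) :
    v ⬝ᵥ (A *ᵥ v) = ∑ i, ∑ k, v i * v k * A i k := by
  simp only [dotProduct, Matrix.mulVec, Finset.mul_sum]
  refine Finset.sum_congr rfl fun i _ => Finset.sum_congr rfl fun k _ => by ring

theorem abs_inner_toEuclideanLin_sub_le (A B : Matrix (Fin m) (Fin m) ℝ)
    (v : EuclideanSpace ℝ (Fin m)) :
    |inner ℝ v (A.toEuclideanLin v) - inner ℝ v (B.toEuclideanLin v)| ≤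
      (∑ i, ∑ k, |A i k - B i k|) * ‖v‖ ^ 2 := by
  rw [inner_toEuclideanLin, inner_toEuclideanLin, dotProduct_mulVec_eq_sum,
    dotProduct_mulVec_eq_sum, ← Finset.sum_sub_distrib, Finset.sum_mul]
  refine (Finset.abs_sum_le_sum_abs _ _).trans (Finset.sum_le_sum fun i _ => ?_)
  rw [← Finset.sum_sub_distrib, Finset.sum_mul]
  refine (Finset.abs_sum_le_sum_abs _ _).trans (Finset.sum_le_sum fun k _ => ?_)
  rw [← mul_sub, abs_mul, mul_comm]
  gcongr
  simpa using norm_coord_mul_coord_le v i k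

theorem abs_minMax_toEuclideanLin_sub_le (A B : Matrix (Fin m) (Fin m) ℝ) (l : ℕ) :
    |minMax A.toEuclideanLin l - minMax B.toEuclideanLin l| ≤ ∑ i, ∑ k, |A i k - B i k| :=
  abs_minMax_sub_le (abs_inner_toEuclideanLin_sub_le A B) (by positivity) l

/-- Moves the problem from `ℝ^N`, which changes with `N`, to the fixed space `ℝ^m`. -/
theorem singularValues_toEuclideanLin {N : ℕ} (X : Matrix (Fin m) (Fin N) ℝ) (l : ℕ) :
    X.toEuclideanLin.singularValues l = √(minMax (X * Xᵀ).toEuclideanLin l) := by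
  have h : (X * Xᵀ).toEuclideanLin = X.toEuclideanLin ∘ₗ LinearMap.adjoint X.toEuclideanLin := by
    rw [← Matrix.toEuclideanLin_conjTranspose_eq_adjoint,
      Matrix.conjTranspose_eq_transpose_of_trivial]
    exact Matrix.toLpLin_mul_same _ _ _
  rw [h, ← sq_singularValues_eq_minMax, Real.sqrt_sq (LinearMap.singularValues_nonneg _ _)]

/-- The singular values depend continuously on `X Xᵀ`, uniformly in the number of columns. -/
theorem tendsto_singularValues {X : ∀ N : ℕ, Matrix (Fin m) (Fin N) ℝ}
    {B : Matrix (Fin m) (Fin m) ℝ} (h : Tendsto (fun N => X N * (X N)ᵀ) atTop (𝓝 B)) (l : ℕ) :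
    Tendsto (fun N => (X N).toEuclideanLin.singularValues l) atTop
      (𝓝 √(minMax B.toEuclideanLin l)) := by
  simp only [singularValues_toEuclideanLin]
  refine (Real.continuous_sqrt.tendsto _).comp ?_
  rw [tendsto_iff_norm_sub_tendsto_zero]
  refine squeeze_zero (fun _ => norm_nonneg _)
    (fun N => abs_minMax_toEuclideanLin_sub_le (X N * (X N)ᵀ) B l) ?_
  have hc : Continuous fun A : Matrix (Fin m) (Fin m) ℝ => ∑ i, ∑ k, |A i k - B i k| := by
    fun_prop
  have h0 := (hc.tendsto B).comp h
  simp only [sub_self, abs_zero, Finset.sum_const_zero] at h0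
  exact h0

theorem tendsto_directionalValue {X : ∀ N : ℕ, Matrix (Fin m) (Fin N) ℝ}
    {B : Matrix (Fin m) (Fin m) ℝ} (h : Tendsto (fun N => X N * (X N)ᵀ) atTop (𝓝 B))
    (v : EuclideanSpace ℝ (Fin m)) :
    Tendsto (fun N => directionalValue (X N) v) atTop
      (𝓝 (√(v.ofLp ⬝ᵥ (B *ᵥ v.ofLp)) / ‖v‖)) := by
  have hc : Continuous fun A : Matrix (Fin m) (Fin m) ℝ =>
      √(v.ofLp ⬝ᵥ (A *ᵥ v.ofLp)) / ‖v‖ := by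
    simp only [dotProduct_mulVec_eq_sum]
    fun_prop
  exact (hc.tendsto B).comp h

theorem apply_eq_toEuclideanLin_single (A : Matrix (Fin m) (Fin m) ℝ) (i k : Fin m) :
    A i k = A.toEuclideanLin (EuclideanSpace.single k 1) i := by
  simp

theorem minMax_smul {H : Type*} [NormedAddCommGroup H] [InnerProductSpace ℝ H]
    (A : H →ₗ[ℝ] H) {c : ℝ} (hc : 0 ≤ c) (l : ℕ) : minMax (c • A) l = c * minMax A l := by
  simp only [minMax, LinearMap.smul_apply, inner_smul_right, Real.mul_iInf_of_nonneg hc,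
    Real.mul_iSup_of_nonneg hc]

/-- The rows of `tangentProj J` are the images of the standard basis under `J`. -/
noncomputable def tangentProj (J : EuclideanSpace ℝ (Fin d) →ₗᵢ[ℝ] EuclideanSpace ℝ (Fin m)) :
    Matrix (Fin d) (Fin m) ℝ :=
  Matrix.of fun i k => J (EuclideanSpace.single i 1) k

theorem isTangentProj_tangentProj {M : Set (EuclideanSpace ℝ (Fin m))}
    {x : EuclideanSpace ℝ (Fin m)}
    {J : EuclideanSpace ℝ (Fin d) →ₗᵢ[ℝ] EuclideanSpace ℝ (Fin m)}
    (h : tangentAt M x = LinearMap.range J.toLinearMap) : IsTangentProj M x (tangentProj J) := by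
  have happ : ∀ v i, (tangentProj J).toEuclideanLin v i =
      inner ℝ (J (EuclideanSpace.single i 1)) v := fun v i => by
    rw [ofLp_toEuclideanLin, EuclideanSpace.inner_eq_star_dotProduct, dotProduct_comm]
    simp [Matrix.mulVec, tangentProj]
  have hT : ∀ w, (tangentProj J)ᵀ.toEuclideanLin w = J w := fun w => by
    have hw : w = ∑ i, w i • EuclideanSpace.single i (1 : ℝ) := by
      ext j; simp [Finset.sum_apply, Pi.single_apply]
    conv_rhs => rw [hw, map_sum]
    ext k
    rw [ofLp_toEuclideanLin]
    simp [Matrix.mulVec, dotProduct, tangentProj, mul_comm]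
  refine ⟨?_, ?_, ?_⟩
  · ext i j
    have h1 : (tangentProj J * (tangentProj J)ᵀ) i j =
        inner ℝ (J (EuclideanSpace.single i 1)) (J (EuclideanSpace.single j 1)) := by
      rw [EuclideanSpace.inner_eq_star_dotProduct, dotProduct_comm]
      simp [Matrix.mul_apply, dotProduct, tangentProj]
    rw [h1, J.inner_map_map, Matrix.one_apply]
    simp [EuclideanSpace.inner_single_left]
  · rw [h]
    rintro _ ⟨w, rfl⟩
    have h2 : ((tangentProj J)ᵀ * tangentProj J).toEuclideanLin (J w) =
        (tangentProj J)ᵀ.toEuclideanLin ((tangentProj J).toEuclideanLin (J w)) := by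
      have := Matrix.toLpLin_mul_same 2 (tangentProj J)ᵀ (tangentProj J)
      exact congrArg (fun f => f (J w)) this
    have h3 : (tangentProj J).toEuclideanLin (J w) = w := by
      ext i
      rw [happ, J.inner_map_map, ← coord_eq_inner]
    exact h2.trans (by rw [h3, hT]; rfl)
  · intro v hv
    rw [h] at hv
    ext i
    rw [happ]
    exact (Submodule.mem_orthogonal _ _).1 hv _ ⟨_, rfl⟩

/-- Splitting into tangential and normal components shows that `Iᵀ I` does not depend on the
orthonormal basis behind `I`. -/
theorem IsTangentProj.toEuclideanLin_eq {M : Set (EuclideanSpace ℝ (Fin m))}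
    {x : EuclideanSpace ℝ (Fin m)} {I : Matrix (Fin d) (Fin m) ℝ} (hI : IsTangentProj M x I)
    (v : EuclideanSpace ℝ (Fin m)) :
    (Iᵀ * I).toEuclideanLin v = (tangentAt M x).starProjection v := by
  set K := tangentAt M x
  have hnormal : (Iᵀ * I).toEuclideanLin (v - K.starProjection v) = 0 := by
    have h1 := hI.normal _ (K.sub_starProjection_mem_orthogonal v)
    have h2 := congrArg (fun f => f (v - K.starProjection v)) (Matrix.toLpLin_mul_same 2 Iᵀ I)
    refine h2.trans ?_
    rw [LinearMap.comp_apply]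
    erw [h1]
    exact map_zero _
  have h3 := hI.tangent _ (K.starProjection_apply_mem v)
  rw [map_sub, h3, sub_eq_zero] at hnormal
  exact hnormal

end Matrices

/-! ### The large-data limit -/

section LargeData

variable {m : ℕ}

/-- The limit of `(1/ε) X Xᵀ` as the number of samples tends to infinity. -/
noncomputable def limitMatrix (P : Measure (EuclideanSpace ℝ (Fin m)))
    (x : EuclideanSpace ℝ (Fin m)) (ε : ℝ) : Matrix (Fin m) (Fin m) ℝ :=
  Matrix.of fun i k => (∫ y, ((y - x) i * (y - x) k) * gauss ε (y - x) ∂P) /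
    (ε * ∫ y, gauss ε (y - x) ∂P)

theorem integrable_coord_mul_gauss (P : Measure (EuclideanSpace ℝ (Fin m)))
    [IsProbabilityMeasure P] (x : EuclideanSpace ℝ (Fin m)) {ε : ℝ} (hε : 0 < ε) (i k : Fin m) :
    Integrable (fun y => ((y - x) i * (y - x) k) * gauss ε (y - x)) P :=
  integrable_mul_gauss_sub (by fun_prop) zero_le_one (fun y => norm_coord_mul_coord_le _ _ _) hε

theorem integrable_gauss_sub (P : Measure (EuclideanSpace ℝ (Fin m)))
    [IsProbabilityMeasure P] (x : EuclideanSpace ℝ (Fin m)) {ε : ℝ} (hε : 0 < ε) :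
    Integrable (fun y => gauss ε (y - x)) P := by
  simpa using integrable_mul_gauss_sub (P := P) (x := x) (f := fun _ => 1) (C := 1) (a := 0)
    continuous_const zero_le_one (by simp) hε

theorem integral_gauss_sub_pos (P : Measure (EuclideanSpace ℝ (Fin m)))
    [IsProbabilityMeasure P] (x : EuclideanSpace ℝ (Fin m)) {ε : ℝ} (hε : 0 < ε) :
    0 < ∫ y, gauss ε (y - x) ∂P := by
  rw [integral_pos_iff_support_of_nonneg (fun y => (gauss_pos ε _).le)
    (integrable_gauss_sub P x hε)]
  have : Function.support (fun y => gauss ε (y - x)) = Set.univ :=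
    Set.eq_univ_of_forall fun y => (gauss_pos ε _).ne'
  rw [this]
  simp

/-- The quadratic form of the limit matrix is nonnegative. -/
theorem dotProduct_limitMatrix_nonneg (P : Measure (EuclideanSpace ℝ (Fin m)))
    [IsProbabilityMeasure P] (x : EuclideanSpace ℝ (Fin m)) {ε : ℝ} (hε : 0 < ε)
    (v : Fin m → ℝ) : 0 ≤ v ⬝ᵥ (limitMatrix P x ε *ᵥ v) := by
  have h : v ⬝ᵥ (limitMatrix P x ε *ᵥ v) =
      (∫ y, (∑ i, v i * (y - x) i) ^ 2 * gauss ε (y - x) ∂P) /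
        (ε * ∫ y, gauss ε (y - x) ∂P) := by
    have h1 : ∀ y, (∑ i, v i * (y - x) i) ^ 2 * gauss ε (y - x) =
        ∑ i, ∑ k, v i * v k * (((y - x) i * (y - x) k) * gauss ε (y - x)) := fun y => by
      rw [sq, Finset.sum_mul_sum, Finset.sum_mul]
      refine Finset.sum_congr rfl fun i _ => ?_
      rw [Finset.sum_mul]
      exact Finset.sum_congr rfl fun k _ => by ring
    simp only [h1]
    rw [dotProduct_mulVec_eq_sum, integral_finsetSum _ fun i _ => integrable_finsetSum _ fun k _ =>
      (integrable_coord_mul_gauss P x hε i k).const_mul _, Finset.sum_div]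
    refine Finset.sum_congr rfl fun i _ => ?_
    rw [integral_finsetSum _ fun k _ => (integrable_coord_mul_gauss P x hε i k).const_mul _,
      Finset.sum_div]
    refine Finset.sum_congr rfl fun k _ => ?_
    rw [integral_const_mul, limitMatrix, Matrix.of_apply, mul_div_assoc]
  rw [h]
  refine div_nonneg (integral_nonneg fun y => mul_nonneg (sq_nonneg _) (gauss_pos ε _).le)
    (mul_nonneg hε.le (integral_gauss_sub_pos P x hε).le)

/-- Each column enters twice, so the weight with `4ε` squares to the Gaussian with `2ε`, and the
square roots of the degree combine. -/
theorem weightedMatrix_mul_transpose (x : EuclideanSpace ℝ (Fin m)) (ε : ℝ) (N : ℕ)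
    (ξ : ℕ → EuclideanSpace ℝ (Fin m)) (i k : Fin m) :
    (weightedMatrix x ε N ξ * (weightedMatrix x ε N ξ)ᵀ) i k =
      (∑ j ∈ Finset.range N, ((ξ j - x) i * (ξ j - x) k) * gauss ε (ξ j - x)) /
        ∑ j ∈ Finset.range N, gauss ε (ξ j - x) := by
  have hD : degree x ε N ξ = ∑ j ∈ Finset.range N, gauss ε (ξ j - x) :=
    Fin.sum_univ_eq_sum_range (fun j => gauss ε (ξ j - x)) N
  have hD0 : 0 ≤ degree x ε N ξ := hD ▸ Finset.sum_nonneg fun j _ => (gauss_pos ε _).le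
  rw [← hD, ← Fin.sum_univ_eq_sum_range
    (fun j => ((ξ j - x) i * (ξ j - x) k) * gauss ε (ξ j - x)) N, Matrix.mul_apply, Finset.sum_div]
  refine Finset.sum_congr rfl fun j _ => ?_
  have hg : gauss ε (ξ j - x) = Real.exp (-‖ξ j - x‖ ^ 2 / (4 * ε)) ^ 2 := by
    rw [gauss, sq (Real.exp _), ← Real.exp_add]; congr 1; ring
  have hs : (degree x ε N ξ)⁻¹ = (√(degree x ε N ξ))⁻¹ ^ 2 := by
    rw [inv_pow, Real.sq_sqrt hD0]
  rw [div_eq_mul_inv, hs, hg]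
  simp only [weightedMatrix, Matrix.transpose_apply, Matrix.of_apply]
  ring

/-- The strong law of large numbers for a function of i.i.d. samples. -/
theorem tendsto_average_ae {E : Type*} [TopologicalSpace E] [MeasurableSpace E] [BorelSpace E]
    {P : Measure E} {Ω : Type*} [MeasurableSpace Ω]
    {μ : Measure Ω} {ξ : ℕ → Ω → E} (hξ : ∀ j, Measurable (ξ j)) (hind : iIndepFun ξ μ)
    (hlaw : ∀ j, μ.map (ξ j) = P) {f : E → ℝ} (hf : Continuous f) (hfi : Integrable f P) :
    ∀ᵐ w ∂μ, Tendsto (fun N : ℕ => (∑ j ∈ Finset.range N, f (ξ j w)) / N) atTop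
      (𝓝 (∫ y, f y ∂P)) := by
  have h0 : Integrable (fun w => f (ξ 0 w)) μ := by
    rw [← hlaw 0] at hfi
    exact hfi.comp_measurable (hξ 0)
  have h := strong_law_ae_real (fun j w => f (ξ j w)) h0
    (fun i j hij => (hind.indepFun hij).comp hf.measurable hf.measurable)
    (fun j => (IdentDistrib.mk (hξ j).aemeasurable (hξ 0).aemeasurable
      ((hlaw j).trans (hlaw 0).symm)).comp hf.measurable)
  have hinteg : ∫ w, f (ξ 0 w) ∂μ = ∫ y, f y ∂P := by
    rw [← hlaw 0, integral_map (hξ 0).aemeasurable hf.measurable.aestronglyMeasurable]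
  rwa [hinteg] at h

theorem tendsto_weightedMatrix_mul_transpose (P : Measure (EuclideanSpace ℝ (Fin m)))
    [IsProbabilityMeasure P] (x : EuclideanSpace ℝ (Fin m)) {Ω : Type*} [MeasurableSpace Ω]
    {μ : Measure Ω} {ξ : ℕ → Ω → EuclideanSpace ℝ (Fin m)} (hξ : ∀ j, Measurable (ξ j))
    (hind : iIndepFun ξ μ) (hlaw : ∀ j, μ.map (ξ j) = P) {ε : ℝ} (hε : 0 < ε) :
    ∀ᵐ w ∂μ, Tendsto (fun N : ℕ => weightedMatrix x ε N (fun j => ξ j w) *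
      (weightedMatrix x ε N (fun j => ξ j w))ᵀ) atTop (𝓝 (ε • limitMatrix P x ε)) := by
  have hgc : Continuous fun y : EuclideanSpace ℝ (Fin m) => gauss ε (y - x) :=
    (continuous_gauss ε).comp (continuous_id.sub continuous_const)
  have hD := tendsto_average_ae hξ hind hlaw hgc (integrable_gauss_sub P x hε)
  have hS : ∀ᵐ w ∂μ, ∀ i k, Tendsto (fun N : ℕ => (∑ j ∈ Finset.range N,
      ((ξ j w - x) i * (ξ j w - x) k) * gauss ε (ξ j w - x)) / (N : ℝ)) atTop
      (𝓝 (∫ y, ((y - x) i * (y - x) k) * gauss ε (y - x) ∂P)) := by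
    rw [ae_all_iff]
    intro i
    rw [ae_all_iff]
    intro k
    exact tendsto_average_ae hξ hind hlaw
      (f := fun y => ((y - x) i * (y - x) k) * gauss ε (y - x)) (by fun_prop)
      (integrable_coord_mul_gauss P x hε i k)
  filter_upwards [hD, hS] with w hDw hSw
  refine tendsto_pi_nhds.2 fun i => tendsto_pi_nhds.2 fun k => ?_
  have hpos := integral_gauss_sub_pos P x hε
  have hlim : (ε • limitMatrix P x ε) i k = (∫ y, ((y - x) i * (y - x) k) * gauss ε (y - x) ∂P) /
      ∫ y, gauss ε (y - x) ∂P := by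
    rw [Matrix.smul_apply, limitMatrix, Matrix.of_apply, smul_eq_mul]
    field_simp
  rw [hlim]
  refine ((hSw i k).div hDw hpos.ne').congr' ?_
  -- The factor `1 / N` turning sums into averages cancels in the quotient.
  filter_upwards [eventually_ne_atTop 0] with N hN
  rw [weightedMatrix_mul_transpose]
  have : (N : ℝ) ≠ 0 := Nat.cast_ne_zero.2 hN
  exact div_div_div_cancel_right₀ this _ _

end LargeData

/-! ### Square roots of expansions -/

section Sqrt

/-- From `s - ε = (√s - √ε)(√s + √ε)`. Negative `s`, where `√s = 0`, is included so that no sign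
condition is needed later. -/
theorem abs_sqrt_sub_sqrt_mul_le {s ε : ℝ} (hε : 0 ≤ ε) : |√s - √ε| * √ε ≤ |s - ε| := by
  rcases le_total 0 s with hs | hs
  · have h1 : s - ε = (√s - √ε) * (√s + √ε) := by
      nlinarith [Real.sq_sqrt hs, Real.sq_sqrt hε]
    have h2 := Real.sqrt_nonneg s
    have h3 := Real.sqrt_nonneg ε
    rw [h1, abs_mul, abs_of_nonneg (add_nonneg h2 h3)]
    gcongr
    linarith
  · rw [Real.sqrt_eq_zero_of_nonpos hs, zero_sub, abs_neg, abs_of_nonneg (Real.sqrt_nonneg ε),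
      Real.mul_self_sqrt hε, abs_of_nonpos (by linarith)]
    linarith

theorem sqrt_sub_sqrt_isBigO {s : ℝ → ℝ}
    (h : (fun ε => s ε - ε) =O[𝓝[>] 0] fun ε : ℝ => ε ^ 2) :
    (fun ε => √(s ε) - √ε) =O[𝓝[>] 0] fun ε : ℝ => ε := by
  obtain ⟨C, hC0, hC⟩ := h.exists_nonneg
  refine IsBigO.of_bound C ?_
  filter_upwards [hC.bound, Ioo_mem_nhdsGT one_pos] with ε h1 hε
  have hε0 : 0 < ε := hε.1
  have hsq : 0 < √ε := Real.sqrt_pos.2 hε0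
  have h2 := abs_sqrt_sub_sqrt_mul_le (s := s ε) hε0.le
  rw [Real.norm_of_nonneg (sq_nonneg ε)] at h1
  rw [Real.norm_of_nonneg hε0.le, Real.norm_eq_abs]
  have h3 : ε ≤ √ε := Real.le_sqrt_of_sq_le (by nlinarith [hε.2])
  refine le_of_mul_le_mul_right ?_ hsq
  calc |√(s ε) - √ε| * √ε ≤ C * ε ^ 2 := h2.trans h1
    _ = C * ε * ε := by ring
    _ ≤ C * ε * √ε := by gcongr

theorem sqrt_isBigO {s : ℝ → ℝ} (h : s =O[𝓝[>] 0] fun ε : ℝ => ε ^ 2) :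
    (fun ε => √(s ε)) =O[𝓝[>] 0] fun ε : ℝ => ε := by
  obtain ⟨C, hC0, hC⟩ := h.exists_nonneg
  refine IsBigO.of_bound √C ?_
  filter_upwards [hC.bound, self_mem_nhdsWithin] with ε h1 hε
  have hε : 0 < ε := hε
  rw [Real.norm_of_nonneg (sq_nonneg ε)] at h1
  rw [Real.norm_of_nonneg hε.le, Real.norm_of_nonneg (Real.sqrt_nonneg _),
    ← Real.sqrt_sq hε.le, ← Real.sqrt_mul hC0, Real.sqrt_sq hε.le]
  exact Real.sqrt_le_sqrt ((le_abs_self _).trans h1)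

end Sqrt

/-! ### Consequences of the expansion of the limit matrix -/

section Consequences

variable {m : ℕ} {K : Submodule ℝ (EuclideanSpace ℝ (Fin m))}
  {L : ℝ → Matrix (Fin m) (Fin m) ℝ} {R : Matrix (Fin m) (Fin m) ℝ}

/-- The matrix of the orthogonal projection onto `K`. -/
noncomputable def projMatrix (K : Submodule ℝ (EuclideanSpace ℝ (Fin m))) :
    Matrix (Fin m) (Fin m) ℝ :=
  Matrix.of fun i k => K.starProjection (EuclideanSpace.single k 1) i

theorem eq_projMatrix {A : Matrix (Fin m) (Fin m) ℝ}
    (h : ∀ v, A.toEuclideanLin v = K.starProjection v) : A = projMatrix K := by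
  ext i k
  exact (apply_eq_toEuclideanLin_single A i k).trans (by rw [h]; rfl)

theorem toEuclideanLin_projMatrix (K : Submodule ℝ (EuclideanSpace ℝ (Fin m))) :
    (projMatrix K).toEuclideanLin = K.starProjection.toLinearMap := by
  have h : Matrix.toEuclideanLin (Matrix.toEuclideanLin.symm K.starProjection.toLinearMap) =
      K.starProjection.toLinearMap := LinearEquiv.apply_symm_apply _ _
  rw [← eq_projMatrix (fun v => congrArg (fun f => f v) h), h]

theorem dotProduct_expansion
    (hL : ∀ i k, (fun ε : ℝ => L ε i k - (projMatrix K i k + ε * R i k)) =O[𝓝[>] 0]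
      fun ε : ℝ => ε ^ 2) (v : EuclideanSpace ℝ (Fin m)) :
    (fun ε : ℝ => v.ofLp ⬝ᵥ (L ε *ᵥ v.ofLp) - (inner ℝ v (K.starProjection v) +
      ε * (v.ofLp ⬝ᵥ (R *ᵥ v.ofLp)))) =O[𝓝[>] 0] fun ε : ℝ => ε ^ 2 := by
  have h1 : inner ℝ v (K.starProjection v) = v.ofLp ⬝ᵥ (projMatrix K *ᵥ v.ofLp) := by
    rw [← inner_toEuclideanLin, toEuclideanLin_projMatrix]; rfl
  simp only [h1, dotProduct_mulVec_eq_sum]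
  refine (IsBigO.fun_sum (s := Finset.univ) fun i _ => IsBigO.fun_sum (s := Finset.univ)
    fun k _ => (hL i k).const_mul_left (v i * v k)).congr_left fun ε => ?_
  simp only [Finset.mul_sum, ← Finset.sum_add_distrib, ← Finset.sum_sub_distrib]
  exact Finset.sum_congr rfl fun i _ => Finset.sum_congr rfl fun k _ => by ring

theorem isBigO_mul_self {f : ℝ → ℝ} {n : ℕ} (h : f =O[𝓝[>] 0] fun ε : ℝ => ε ^ n) :
    (fun ε => ε * f ε) =O[𝓝[>] 0] fun ε : ℝ => ε ^ (n + 1) :=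
  ((isBigO_refl (fun ε : ℝ => ε) _).mul h).congr_right fun ε => by ring

theorem sub_isBigO_of_expansion {f : ℝ → ℝ} {a b : ℝ}
    (h : (fun ε : ℝ => f ε - (a + ε * b)) =O[𝓝[>] 0] fun ε : ℝ => ε ^ 2) :
    (fun ε : ℝ => f ε - a) =O[𝓝[>] 0] fun ε : ℝ => ε ^ 1 := by
  have h1 : (fun ε : ℝ => ε ^ 2) =O[𝓝[>] 0] fun ε : ℝ => ε ^ 1 := by
    refine IsBigO.of_norm_norm ?_
    simpa only [norm_pow] using (norm_pow_isBigO_norm_pow (V := ℝ)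
      (show 1 ≤ 2 by norm_num)).mono nhdsWithin_le_nhds
  have h2 : (fun ε : ℝ => b * ε) =O[𝓝[>] 0] fun ε : ℝ => ε ^ 1 := by
    simpa using (isBigO_refl (fun ε : ℝ => ε) (𝓝[>] 0)).const_mul_left b
  exact ((h.trans h1).add h2).congr_left fun ε => by ring

/-- The prefactor `ε` comes out by homogeneity, and the Lipschitz bound turns the entrywise `O(ε)`
distance to the projection into a total error `O(ε²)`. -/
theorem minMax_expansion
    (hL : ∀ i k, (fun ε : ℝ => L ε i k - (projMatrix K i k + ε * R i k)) =O[𝓝[>] 0]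
      fun ε : ℝ => ε ^ 2) (l : ℕ) :
    (fun ε : ℝ => minMax (ε • L ε).toEuclideanLin l -
      ε * minMax K.starProjection.toLinearMap l) =O[𝓝[>] 0] fun ε : ℝ => ε ^ 2 := by
  have h1 : (fun ε : ℝ => ∑ i, ∑ k, |L ε i k - projMatrix K i k|) =O[𝓝[>] 0]
      fun ε : ℝ => ε ^ 1 :=
    IsBigO.fun_sum fun i _ => IsBigO.fun_sum fun k _ => (sub_isBigO_of_expansion (hL i k)).abs_left
  refine IsBigO.trans (IsBigO.of_bound 1 ?_) (isBigO_mul_self h1)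
  filter_upwards [self_mem_nhdsWithin] with ε hε
  have hε : 0 < ε := hε
  have h2 := abs_minMax_toEuclideanLin_sub_le (L ε) (projMatrix K) l
  rw [toEuclideanLin_projMatrix] at h2
  rw [map_smul, minMax_smul _ hε.le, ← mul_sub, norm_mul, norm_mul, one_mul]
  gcongr
  exact h2.trans (le_abs_self _)

end Consequences

end TangentSVD

theorem corollary1 {m d : ℕ}
    (M : Set (EuclideanSpace ℝ (Fin m))) (hM : TangentSVD.IsSubmanifold d M)
    (p : EuclideanSpace ℝ (Fin m) → ℝ) (hp : ContDiffOn ℝ ∞ p M) (hp0 : ∀ y ∈ M, 0 ≤ p y)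
    (P : Measure (EuclideanSpace ℝ (Fin m))) [IsProbabilityMeasure P]
    (hP : TangentSVD.HasVolumeDensity d M p P)
    (x : EuclideanSpace ℝ (Fin m)) (hx : x ∈ M) (hpx : 0 < p x) :
    -- the remainder `R`, and the (deterministic) large-data limits `L ε` of `(1/ε) X Xᵀ`,
    -- `σ ε l` of the ordered singular values of `X`, `τ ε v` of `√(vᵀ X Xᵀ v) / ‖v‖`
    ∃ (R : Matrix (Fin m) (Fin m) ℝ) (L : ℝ → Matrix (Fin m) (Fin m) ℝ)
      (σ : ℝ → ℕ → ℝ) (τ : ℝ → EuclideanSpace ℝ (Fin m) → ℝ),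
      -- the limits hold almost surely, for any i.i.d. samples `ξ 0, ξ 1, …` with law `P`
      (∀ (Ω : Type*) [MeasurableSpace Ω] (μ : Measure Ω) [IsProbabilityMeasure μ]
        (ξ : ℕ → Ω → EuclideanSpace ℝ (Fin m)),
        (∀ j, Measurable (ξ j)) → iIndepFun ξ μ → (∀ j, μ.map (ξ j) = P) →
        ∀ ε : ℝ, 0 < ε → ∀ᵐ w ∂μ,
          Tendsto (fun N : ℕ =>
            (1 / ε) • (TangentSVD.weightedMatrix x ε N (fun j => ξ j w) *
              (TangentSVD.weightedMatrix x ε N (fun j => ξ j w))ᵀ)) atTop (𝓝 (L ε)) ∧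
          (∀ l : ℕ, Tendsto (fun N : ℕ =>
            (TangentSVD.weightedMatrix x ε N (fun j => ξ j w)).toEuclideanLin.singularValues l)
              atTop (𝓝 (σ ε l))) ∧
          (∀ v : EuclideanSpace ℝ (Fin m), Tendsto (fun N : ℕ =>
            TangentSVD.directionalValue (TangentSVD.weightedMatrix x ε N (fun j => ξ j w)) v)
              atTop (𝓝 (τ ε v)))) ∧
      -- `L ε = Iᵀ I + ε R + O(ε²)`, where `Iᵀ I` is the orthogonal projection onto `T_x M`
      (∃ I : Matrix (Fin d) (Fin m) ℝ, TangentSVD.IsTangentProj M x I) ∧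
      (∀ I : Matrix (Fin d) (Fin m) ℝ, TangentSVD.IsTangentProj M x I →
        (∀ v, (Iᵀ * I).toEuclideanLin v = (TangentSVD.tangentAt M x).starProjection v) ∧
        ∀ i k, (fun ε : ℝ => L ε i k - ((Iᵀ * I) i k + ε * R i k)) =O[𝓝[>] 0]
          fun ε : ℝ => ε ^ 2) ∧
      -- `d` singular values are `√ε + O(ε)`, the remaining ones are `O(ε)`
      (∀ l < d, (fun ε : ℝ => σ ε l - √ε) =O[𝓝[>] 0] fun ε : ℝ => ε) ∧
      (∀ l, d ≤ l → (fun ε : ℝ => σ ε l) =O[𝓝[>] 0] fun ε : ℝ => ε) ∧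
      -- the order `√ε` belongs to the tangent directions, the order `ε` to the normal ones
      (∀ v ∈ TangentSVD.tangentAt M x, v ≠ 0 →
        (fun ε : ℝ => τ ε v - √ε) =O[𝓝[>] 0] fun ε : ℝ => ε) ∧
      (∀ v ∈ (TangentSVD.tangentAt M x)ᗮ,
        ((fun ε : ℝ => τ ε v) =O[𝓝[>] 0] fun ε : ℝ => ε) ∧
        (fun ε : ℝ => (τ ε v * ‖v‖) ^ 2 - ε ^ 2 * (v.ofLp ⬝ᵥ (R *ᵥ v.ofLp))) =O[𝓝[>] 0]
          fun ε : ℝ => ε ^ 3) := by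
  obtain ⟨U, φ, J, hφ, h0, hφx, hJ⟩ := hM.exists_isometric_param hx
  have hK : TangentSVD.tangentAt M x = LinearMap.range J.toLinearMap :=
    hφ.tangentAt_eq_range h0 hφx hJ
  have hdim : Module.finrank ℝ (TangentSVD.tangentAt M x) = d := by
    rw [hK, LinearMap.finrank_range_of_inj J.injective]; simp
  obtain ⟨c₁, hD⟩ := hφ.degree_expansion hp hp0 hP h0 hφx hJ
  choose c₂ hS using fun i k => hφ.moment_expansion hp hp0 hP h0 hφx hJ hK i k
  set g : ℝ := p x * ∫ u : EuclideanSpace ℝ (Fin d), TangentSVD.gauss 1 u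
  have hg : 0 < g := mul_pos hpx TangentSVD.integral_gauss_pos
  set K := TangentSVD.tangentAt M x
  set L := TangentSVD.limitMatrix P x with hLdef
  -- The first-order coefficient of the quotient of the second-moment and degree expansions.
  set R : Matrix (Fin m) (Fin m) ℝ :=
    Matrix.of fun i k => (c₂ i k - c₁ * TangentSVD.projMatrix K i k) / g
  have hL : ∀ i k, (fun ε : ℝ => L ε i k - (TangentSVD.projMatrix K i k + ε * R i k))
      =O[𝓝[>] 0] fun ε : ℝ => ε ^ 2 := fun i k => TangentSVD.ratio_expansion hg hD (hS i k)
  have hquad := TangentSVD.dotProduct_expansion hL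
  have hquad' : ∀ v : EuclideanSpace ℝ (Fin m), ∀ ε : ℝ,
      v.ofLp ⬝ᵥ ((ε • L ε) *ᵥ v.ofLp) = ε * (v.ofLp ⬝ᵥ (L ε *ᵥ v.ofLp)) := fun v ε => by
    rw [Matrix.smul_mulVec, dotProduct_smul, smul_eq_mul]
  have hnormal : ∀ v ∈ Kᗮ, inner ℝ v (K.starProjection v) = 0 := fun v hv => by
    rw [(Submodule.starProjection_apply_eq_zero_iff K).2 hv, inner_zero_right]
  refine ⟨R, L, fun ε l => √(TangentSVD.minMax (ε • L ε).toEuclideanLin l),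
    fun ε v => √(v.ofLp ⬝ᵥ ((ε • L ε) *ᵥ v.ofLp)) / ‖v‖, ?_,
    ⟨_, TangentSVD.isTangentProj_tangentProj hK⟩, fun I hI => ⟨hI.toEuclideanLin_eq, ?_⟩,
    fun l hl => ?_, fun l hl => ?_, fun v hv hv0 => ?_, fun v hv => ⟨?_, ?_⟩⟩
  · intro Ω _ μ _ ξ hξ hind hlaw ε hε
    filter_upwards [TangentSVD.tendsto_weightedMatrix_mul_transpose P x hξ hind hlaw hε] with w hw
    refine ⟨?_, TangentSVD.tendsto_singularValues hw, TangentSVD.tendsto_directionalValue hw⟩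
    have := hw.const_smul (1 / ε)
    rwa [smul_smul, one_div_mul_cancel hε.ne', one_smul, ← hLdef] at this
  · rw [TangentSVD.eq_projMatrix hI.toEuclideanLin_eq]
    exact hL
  · refine TangentSVD.sqrt_sub_sqrt_isBigO ?_
    have := TangentSVD.minMax_expansion hL l
    rw [TangentSVD.minMax_starProjection_of_lt K (hdim ▸ hl)] at this
    simpa using this
  · refine TangentSVD.sqrt_isBigO ?_
    have := TangentSVD.minMax_expansion hL l
    rw [TangentSVD.minMax_starProjection_of_le K (hdim ▸ hl)] at this
    simpa using this
  · have hv2 : ‖v‖ ^ 2 ≠ 0 := pow_ne_zero 2 (norm_ne_zero_iff.2 hv0)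
    have h1 := TangentSVD.sub_isBigO_of_expansion (hquad v)
    rw [Submodule.starProjection_eq_self_iff.2 hv, real_inner_self_eq_norm_sq] at h1
    have h2 : (fun ε : ℝ => v.ofLp ⬝ᵥ ((ε • L ε) *ᵥ v.ofLp) / ‖v‖ ^ 2 - ε) =O[𝓝[>] 0]
        fun ε : ℝ => ε ^ 2 := by
      refine ((TangentSVD.isBigO_mul_self h1).const_mul_left (‖v‖ ^ 2)⁻¹).congr_left fun ε => ?_
      rw [hquad']
      field_simp
    refine (TangentSVD.sqrt_sub_sqrt_isBigO h2).congr_left fun ε => ?_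
    rw [Real.sqrt_div' _ (sq_nonneg _), Real.sqrt_sq (norm_nonneg v)]
  · have h1 := TangentSVD.sub_isBigO_of_expansion (hquad v)
    rw [hnormal v hv] at h1
    have h2 : (fun ε : ℝ => v.ofLp ⬝ᵥ ((ε • L ε) *ᵥ v.ofLp)) =O[𝓝[>] 0]
        fun ε : ℝ => ε ^ 2 :=
      (TangentSVD.isBigO_mul_self h1).congr_left fun ε => by rw [hquad', sub_zero]
    exact ((TangentSVD.sqrt_isBigO h2).const_mul_left ‖v‖⁻¹).congr_left fun ε =>
      (div_eq_inv_mul _ _).symm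
  -- For normal `v` the projection term vanishes, so the extra factor `ε` leaves `ε² vᵀ R v` with
  -- error `O(ε³)`.
  · have h1 := TangentSVD.isBigO_mul_self (hquad v)
    rw [hnormal v hv] at h1
    refine h1.congr' ?_ EventuallyEq.rfl
    filter_upwards [self_mem_nhdsWithin] with ε hε
    have hε : 0 < ε := hε
    -- Needed because squaring `√` recovers its argument only when that is nonnegative.
    have hnn : 0 ≤ v.ofLp ⬝ᵥ ((ε • L ε) *ᵥ v.ofLp) := by
      rw [hquad']
      exact mul_nonneg hε.le (TangentSVD.dotProduct_limitMatrix_nonneg P x hε _)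
    have h3 : (√(v.ofLp ⬝ᵥ ((ε • L ε) *ᵥ v.ofLp)) / ‖v‖ * ‖v‖) ^ 2 =
        v.ofLp ⬝ᵥ ((ε • L ε) *ᵥ v.ofLp) := by
      rcases eq_or_ne v 0 with rfl | hv0
      · simp
      · rw [div_mul_cancel₀ _ (norm_ne_zero_iff.2 hv0), Real.sq_sqrt hnn]
    rw [h3, hquad']
    ring
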